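/- **Setting.** A source consists of $s$ i.i.d. Bernoulli$(1/2)$ bits. There are $m\ge 1$ decoders; decoder $i\in[m]=\{1,\dots,m\}$ has a set $\mathbf Y_i$ of source bits as side information and demands a set $\mathbf f_i$ of source bits with $\mathbf f_i\cap\mathbf Y_i=\emptyset$. Sets of bits are also read as random vectors. An $(n,M)$ code encodes $n$ independent copies of the source into $\{1,\dots,M\}$, and decoder $i$ reconstructs its $n$ copies of $\mathbf f_i$ from the codeword and its $n$ copies of $\mathbf Y_i$. A rate $R$ is achievable if there is a sequence of $(n,M_n)$ codes with $n^{-1}\log_2M_n\le R$ for which the probability that some decoder errs tends to $0$; $R_{opt}$ is the infimum of the achievable rates. For $I,J\subseteq[m]$ let $f_{IJ}$ be the set of bits demanded by exactly the decoders in $I$ and missing as side information at exactly the decoders in $J$ (write $f_{jJ}$ for $f_{\{j\}J}$), and let $\mathbf f_j'=\mathbf f_j\setminus\bigcup_{\beta\ne j}f_{j\{j,\beta\}}$. **Admissible selections.** A selection gives each $I\subseteq[m]$ a message $U_I$, a vector of mod-2 sums of source bits. It is admissible if (1) each decoder $i$ can compute $\mathbf f_i$ from $\mathbf Y_i$ and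 the $U_I$ with $i\in I$; (2) the $U_I$ are independent, and any two disjoint collections of the $U_I$ are conditionally independent given any collection of $U_L$'s and $\mathbf Y_i$'s. Its rate is $\sum_I\max_{i\in I}H(U_I\mid\mathbf Y_i)$. **CAPM** chooses a selection as follows (bits and decoders are numbered; bits demanded by nobody are discarded). *Step 1.* A bit of $f_{KJ}$ is put into $U_{K\cup J^c}$ if $J\ne[m]$, and into $U_{[m]}$ if $J=[m]$. *Step 2.* Treat the messages $U_I$, $I\ne[m]$, by nondecreasing $|I|$, in any order for equal $|I|$. As long as $H(U_I\mid\mathbf Y_i)$ is not constant over $i\in I$, let $i^*$ and $j^*$ be the least indices in $I$ that minimize and maximize it, and move the lowest bit of $U_I$ that $i^*$ has and $j^*$ lacks to $U_{I\cup\{x\}}$, where $x\notin I$ is the least index with $U_{I\cup\{x\}}$ nonempty, or the least index outside $I$ if there is none. *Step 3.* For each $I$ list, in any order, the excess bits of $U_I$ (those that were moved there in Step 2) as $V_1,\dots,V_l$; let $N_i$ and $H_i$ be the sets of decoders that demand and that have $V_i$. Search the pairs $i<j$, by increasing $i$ and then increasing $j$, for the first one with $N_i\subseteq H_j$, $N_j\subseteq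 H_i$ and $V_i,V_j$ put in the same message in Step 1; replace $V_i,N_i,H_i$ by $V_i\oplus V_j$, $N_i\cup N_j$, $H_i\cap H_j$ and delete $V_j$ (the new $V_i$ counts as put in the same Step 1 message). Repeat until there is no such pair. **Theorem.** Suppose that every source bit is side information of none, of all, of all but one, or of all but two of the $m$ decoders. Then $$R_{opt}=\max\{R_1,\dots,R_m\},$$ $$R_i=H\big(\mathbf f_1',\dots,\mathbf f_{i-1}',\,\mathbf f_i,\,\mathbf f_{i+1}',\dots,\mathbf f_m'\,\big|\,\mathbf Y_i\big)+\max_{j\in[m]\setminus\{i\}}\big|f_{j\{i,j\}}\big|$$ (a maximum over the empty set is $0$). This rate is achieved by CAPM: CAPM terminates with some selection, and every selection it can end with is admissible and has rate exactly $R_{opt}$. Moreover $R_{opt}$ equals the DSM+ lower bound $$R_{DSM+}=\max_\sigma\sum_{k=1}^mH\big(\mathbf f_{\sigma(k)}\,\big|\,\mathbf f_{\sigma(1)},\dots,\mathbf f_{\sigma(k-1)},\mathbf Y_{\sigma(1)},\dots,\mathbf Y_{\sigma(k)}\big),$$ the maximum being over all permutations $\sigma$ of $[m]$. -/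

import Mathlib

/-! ## Probability and entropy on a finite uniform sample space -/

/-- Probability of the event `E` under the uniform distribution on the finite set `Ω`. -/
noncomputable def unifProb {Ω : Type*} (E : Ω → Prop) : ℝ :=
  (Nat.card {ω : Ω // E ω} : ℝ) / (Nat.card Ω : ℝ)

/-- Conditional Shannon entropy `H(X | Y)` in bits, for random variables on the uniform
space `Ω`: the average over `y` of the entropy of the law of `X` given `Y = y`. -/
noncomputable def condEntropy {Ω A B : Type*} [Fintype A] [Fintype B]
    (X : Ω → A) (Y : Ω → B) : ℝ :=
  ∑ y : B, unifProb (fun ω => Y ω = y) *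
    ∑ x : A, Real.negMulLog
      (unifProb (fun ω => X ω = x ∧ Y ω = y) / unifProb (fun ω => Y ω = y)) / Real.log 2

/-- `X` and `Z` are conditionally independent given `W` (uniform distribution on `Ω`). -/
def CondIndepGiven {Ω A B C : Type*} (X : Ω → A) (Z : Ω → B) (W : Ω → C) : Prop :=
  ∀ x z w,
    unifProb (fun ω => X ω = x ∧ Z ω = z ∧ W ω = w) * unifProb (fun ω => W ω = w) =
      unifProb (fun ω => X ω = x ∧ W ω = w) * unifProb (fun ω => Z ω = z ∧ W ω = w)

/-! ## Index coding -/

/-- An index coding instance with `m` decoders and `s` source bits: decoder `α` has the bits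
in `side α` and wants the bits in `demand α`; it demands nothing that it already has. -/
structure IndexCoding (m s : ℕ) where
  side : Fin m → Finset (Fin s)
  demand : Fin m → Finset (Fin s)
  disjoint_demand_side : ∀ α, Disjoint (demand α) (side α)

/-- A realization of the source: `s` bits. The source is uniform, i.e. the bits are i.i.d.
Bernoulli(1/2). -/
abbrev SourceWord (s : ℕ) : Type := Fin s → ZMod 2

/-- The random variable that consists of the source bits in `T`. -/
def bitsOf {s : ℕ} (T : Finset (Fin s)) (ω : SourceWord s) : T → ZMod 2 := fun b => ω b

/-- `H(A | B)` for two collections `A`, `B` of source bits. -/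
noncomputable def bitEntropy {s : ℕ} (A B : Finset (Fin s)) : ℝ :=
  condEntropy (bitsOf A) (bitsOf B)

namespace IndexCoding

variable {m s : ℕ} (P : IndexCoding m s)

/-! ### Codes and the optimal rate -/

/-- An `(n, M)` code: an encoder of blocks of `n` source symbols and one decoding function
per decoder. -/
structure Code (n M : ℕ) where
  enc : (Fin n → SourceWord s) → Fin M
  dec : (α : Fin m) → Fin M → (Fin n → (P.side α → ZMod 2)) → (Fin n → (P.demand α → ZMod 2))

/-- The probability that at least one decoder fails to reproduce its demanded block. -/
noncomputable def Code.errorProb {P : IndexCoding m s} {n M : ℕ} (C : P.Code n M) : ℝ :=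
  unifProb (fun ω : Fin n → SourceWord s =>
    ∃ α, C.dec α (C.enc ω) (fun k => bitsOf (P.side α) (ω k)) ≠
      fun k => bitsOf (P.demand α) (ω k))

/-- `R` is achievable: there is a sequence of codes of rate at most `R` (in bits per source
symbol) whose block error probability vanishes. -/
def Achievable (R : ℝ) : Prop :=
  ∃ (M : ℕ → ℕ) (C : ∀ n, P.Code n (M n)),
    (∀ n, 0 < n → Real.logb 2 (M n) / n ≤ R) ∧
      Filter.Tendsto (fun n => (C n).errorProb) Filter.atTop (nhds 0)

/-- The optimal rate. -/
noncomputable def optimalRate : ℝ := sInf {R : ℝ | P.Achievable R}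

/-! ### The sets `f_{IJ}` and the rate expressions -/

/-- The decoders that demand bit `b`. -/
def needers (b : Fin s) : Finset (Fin m) := Finset.univ.filter fun α => b ∈ P.demand α

/-- The decoders that have bit `b` as side information. -/
def holders (b : Fin s) : Finset (Fin m) := Finset.univ.filter fun α => b ∈ P.side α

/-- `f_{IJ}`: the bits that are demanded by exactly the decoders in `I` and that are missing
at exactly the decoders in `J`. -/
def part (I J : Finset (Fin m)) : Finset (Fin s) :=
  Finset.univ.filter fun b => P.needers b = I ∧ (P.holders b)ᶜ = J

/-- `f_α` without all the parts `f_{α{α,β}}`, `β ≠ α`. -/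
def reducedDemand (α : Fin m) : Finset (Fin s) :=
  P.demand α \ (Finset.univ.erase α).biUnion fun β => P.part {α} {α, β}

/-- `R_i`: the entropy, given `Y_i`, of `f_i` and the reduced demands of all other decoders,
plus the maximum over `j ≠ i` of `|f_{j{i,j}}|` (which is `0` if there is no such `j`). -/
noncomputable def rate (i : Fin m) : ℝ :=
  bitEntropy (P.demand i ∪ (Finset.univ.erase i).biUnion P.reducedDemand) (P.side i) +
    (((Finset.univ.erase i).sup fun j => (P.part {j} {i, j}).card : ℕ) : ℝ)

/-- The DSM+ bound: the maximum over all permutations `σ` of the decoders of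
`∑ k, H(f_{σ k} | f_{σ l} for l < k, Y_{σ l} for l ≤ k)`. -/
noncomputable def dsmPlus : ℝ :=
  ⨆ σ : Equiv.Perm (Fin m), ∑ k : Fin m,
    bitEntropy (P.demand (σ k))
      (((Finset.Iio k).biUnion fun l => P.demand (σ l)) ∪
        ((Finset.Iic k).biUnion fun l => P.side (σ l)))

/-! ### Selections of messages

A selection assigns to every set `I` of decoders a message `U_I`, a vector of bits each of which
is the mod-2 sum of a set of source bits. It is represented by the collection of these sets. -/

/-- The value of a vector of mod-2 sums. -/
def messageValue (V : Finset (Finset (Fin s))) (ω : SourceWord s) : V → ZMod 2 :=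
  fun A => ∑ b ∈ (A : Finset (Fin s)), ω b

/-- The joint value of the messages `U_I`, `I ∈ 𝒥`. -/
def messageValues (U : Finset (Fin m) → Finset (Finset (Fin s)))
    (𝒥 : Finset (Finset (Fin m))) (ω : SourceWord s) : (I : 𝒥) → (U I → ZMod 2) :=
  fun I => messageValue (U I) ω

/-- The admissible selections of the achievability bound: every decoder `i` recovers its demand
from its side information and the messages `U_I` with `i ∈ I`; the messages are independent, and
disjoint collections of messages are conditionally independent given any collection of messages
and side informations. -/
structure Feasible (U : Finset (Fin m) → Finset (Finset (Fin s))) : Prop where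
  decodable : ∀ i : Fin m,
    ∃ g : ((I : (Finset.univ.filter fun I : Finset (Fin m) => i ∈ I)) → (U I → ZMod 2)) →
        (P.side i → ZMod 2) → (P.demand i → ZMod 2),
      ∀ ω : SourceWord s,
        g (messageValues U _ ω) (bitsOf (P.side i) ω) = bitsOf (P.demand i) ω
  indep : ∀ u : (I : Finset (Fin m)) → (U I → ZMod 2),
    unifProb (fun ω : SourceWord s => ∀ I, messageValue (U I) ω = u I) =
      ∏ I, unifProb (fun ω : SourceWord s => messageValue (U I) ω = u I)
  condIndep : ∀ (𝒥 𝒦 ℒ : Finset (Finset (Fin m))) (T : Finset (Fin m)), Disjoint 𝒥 𝒦 →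
    CondIndepGiven (messageValues U 𝒥) (messageValues U 𝒦)
      (fun ω : SourceWord s => (messageValues U ℒ ω, fun i : T => bitsOf (P.side i) ω))

/-- The rate of a selection: the sum over `I` of the maximum over `i ∈ I` of `H(U_I | Y_i)`. -/
noncomputable def messageRate (U : Finset (Fin m) → Finset (Finset (Fin s))) : ℝ :=
  ∑ I : Finset (Fin m), ⨆ i : I, condEntropy (messageValue (U I)) (bitsOf (P.side i))

/-! ### The CAPM scheme -/

/-- The index of the message in which bit `b` is placed initially: `K ∪ Jᶜ` for a bit in `f_{KJ}`
with `J` not the set of all decoders, and the set of all decoders otherwise. -/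
def home (b : Fin s) : Finset (Fin m) :=
  if (P.holders b)ᶜ = Finset.univ then Finset.univ else P.needers b ∪ P.holders b

/-- Step 1: the initial messages, consisting of plain source bits. Bits that nobody demands are
purged. -/
def step1 (I : Finset (Fin m)) : Finset (Fin s) :=
  Finset.univ.filter fun b => (P.needers b).Nonempty ∧ P.home b = I

/-- A single move of Step 2 at `U_I`. The decoder `i` has the least index among those in `I`
that minimize `H(U_I | Y_i)`, the decoder `j` the least index among those that maximize it. If the
two entropies differ, the lowest bit of `U_I` that `i` has and `j` lacks moves to
`U_{I ∪ {x}}`, where `x ∉ I` is the lowest index for which this message is nonempty, or the lowest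
index outside `I` if all these messages are empty. -/
def Move (I : Finset (Fin m)) (U U' : Finset (Fin m) → Finset (Fin s)) : Prop :=
  ∃ (i j : Fin m) (b : Fin s) (x : Fin m),
    IsLeast {i | i ∈ I ∧ ∀ l ∈ I, bitEntropy (U I) (P.side i) ≤ bitEntropy (U I) (P.side l)} i ∧
    IsLeast {j | j ∈ I ∧ ∀ l ∈ I, bitEntropy (U I) (P.side l) ≤ bitEntropy (U I) (P.side j)} j ∧
    bitEntropy (U I) (P.side i) < bitEntropy (U I) (P.side j) ∧
    IsLeast {b | b ∈ U I ∧ b ∈ P.side i ∧ b ∉ P.side j} b ∧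
    IsLeast {x | x ∉ I ∧
      ((∃ y, y ∉ I ∧ (U (insert y I)).Nonempty) → (U (insert x I)).Nonempty)} x ∧
    U' = Function.update (Function.update U I ((U I).erase b))
      (insert x I) (insert b (U (insert x I)))

/-- `U_I` is balanced: `H(U_I | Y_i)` is the same for all `i ∈ I`. -/
def Balanced (I : Finset (Fin m)) (U : Finset (Fin m) → Finset (Fin s)) : Prop :=
  ∀ i ∈ I, ∀ j ∈ I, bitEntropy (U I) (P.side i) = bitEntropy (U I) (P.side j)

/-- Step 2 for the messages in a list, one after the other: bits are moved out of `U_I` until it is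
balanced, then the next message is treated. -/
inductive Step2 : List (Finset (Fin m)) → (Finset (Fin m) → Finset (Fin s)) →
    (Finset (Fin m) → Finset (Fin s)) → Prop
  | nil (U) : Step2 [] U U
  | cons (I L U U' U'') : Relation.ReflTransGen (P.Move I) U U' → P.Balanced I U' →
      Step2 L U' U'' → Step2 (I :: L) U U''

/-- The orders in which Step 2 may treat the messages: all `U_I` with `I` not the set of all
decoders, by nondecreasing level `|I|`, in any order within a level. (Empty messages are not
affected by Step 2.) -/
def IsLevelOrder (L : List (Finset (Fin m))) : Prop :=
  L.Nodup ∧ (∀ I, I ∈ L ↔ I ≠ Finset.univ) ∧ L.Pairwise fun I J => I.card ≤ J.card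

/-- The excess bits of `U_I`: those that were not placed there in Step 1. -/
def excess (U : Finset (Fin m) → Finset (Fin s)) (I : Finset (Fin m)) : Finset (Fin s) :=
  (U I).filter fun b => P.home b ≠ I

/-- A component `V` treated in Step 3: the mod-2 sum of the source bits in `support`, with the set
of decoders that need it, the set of decoders that have it, and the index of its initial message. -/
structure Component (m s : ℕ) where
  support : Finset (Fin s)
  need : Finset (Fin m)
  held : Finset (Fin m)
  origin : Finset (Fin m)

/-- A source bit as a component. -/
def ofBit (b : Fin s) : Component m s := ⟨{b}, P.needers b, P.holders b, P.home b⟩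

/-- The exclusive-OR of two components. -/
def Component.xor (V W : Component m s) : Component m s :=
  ⟨symmDiff V.support W.support, V.need ∪ W.need, V.held ∩ W.held, V.origin⟩

/-- The condition under which two components may be combined. -/
def Component.Compatible (V W : Component m s) : Prop :=
  V.need ⊆ W.held ∧ W.need ⊆ V.held ∧ V.origin = W.origin

/-- One round of Step 3 on the list `V_1, …, V_l` of components: search through the pairs
`V_i, V_j`, `i < j`, by increasing `i` and then increasing `j`; for the first pair that may be
combined replace `V_i` by the exclusive-OR and delete `V_j`. -/
def XorStep (L L' : List (Component m s)) : Prop :=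
  ∃ (i j : ℕ) (hij : i < j) (hj : j < L.length),
    (L[i]'(hij.trans hj)).Compatible L[j] ∧
    (∀ (i' j' : ℕ) (hij' : i' < j') (hj' : j' < L.length),
      (L[i']'(hij'.trans hj')).Compatible L[j'] → i < i' ∨ (i = i' ∧ j ≤ j')) ∧
    L' = (L.set i ((L[i]'(hij.trans hj)).xor L[j])).eraseIdx j

/-- `U` is an outcome of CAPM: Step 1, then Step 2 in some order of the messages, then Step 3 for
every message, with its excess bits listed in some order, until no pair can be combined. -/
def IsCAPMOutcome (U : Finset (Fin m) → Finset (Finset (Fin s))) : Prop :=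
  ∃ (order : List (Finset (Fin m))) (W : Finset (Fin m) → Finset (Fin s)),
    IsLevelOrder order ∧ P.Step2 order P.step1 W ∧
    ∀ I, ∃ (B : List (Fin s)) (L : List (Component m s)),
      B.Nodup ∧ B.toFinset = P.excess W I ∧
      Relation.ReflTransGen XorStep (B.map P.ofBit) L ∧ (∀ L', ¬ XorStep L L') ∧
      U I = (W I \ P.excess W I).image (fun b => {b}) ∪ (L.map Component.support).toFinset

end IndexCoding

/-! Everything follows from a cycle of inequalities for an arbitrary CAPM outcome `U`: its rate is
at most some `rate i`, every `rate i` is at most `dsmPlus`, `dsmPlus` is at most every achievable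
rate, and the rate of `U` is achievable. All entropies involved count bits or components with
disjoint supports, so the work is combinatorial.

Converse: in the order `σ`, the codeword and the bits outside `allNewBits σ` determine a correctly
decoded source block, decoder after decoder (`eq_of_decoded`). Counting the correctly decoded blocks
bounds the size of the code (`card_le_of_code`).

Rates against DSM+: let `σ` start with `i` and a `j` that maximizes `|f_{j{i,j}}|`. A bit counted in
the entropy part of `rate i` is demanded by `i` or held by nobody, and the bits of `f_{j{i,j}}`
become new in second place (`rate_le_dsmPlus`).

Upper bound: Step 1 puts everything into `U_[m]` except bits demanded by one decoder `k` and missing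
at `k` and one other decoder `j`; these go to the message indexed by `{j}ᶜ`. Hence Step 2 can move
bits only into `U_[m]`. In Step 3 two components from `{j}ᶜ` can be combined as soon as their needs
are disjoint, and the greedy search leaves components whose needs all share a decoder `k`
(`IsXorState.exists_common_need`). So these components number at most the bits of `f_{k{j,k}}` that
moved. By balance the message `{j}ᶜ` costs just the bits of `f_{k{j,k}}` that stayed. Together they
cost at most `|f_{k{j,k}}|` (`card_meeting_privateBits_add_le`).

Achievability: for each `U_I` send as many Vandermonde combinations of its components over a field
with `2 ^ n` elements as the worst decoder in `I` lacks components (`exists_zero_error_code`). -/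

/-! ### Entropies as cardinalities -/

theorem unifProb_eq_card {Ω : Type*} [Fintype Ω] (E : Ω → Prop) [DecidablePred E] :
    unifProb E = ((Finset.univ.filter E).card : ℝ) / (Fintype.card Ω : ℝ) := by
  rw [unifProb, Nat.card_eq_fintype_card, Nat.card_eq_fintype_card, Fintype.card_subtype]

theorem unifProb_congr {Ω : Type*} {E F : Ω → Prop} (h : ∀ ω, E ω ↔ F ω) :
    unifProb E = unifProb F := by
  have : E = F := funext fun ω => propext (h ω)
  rw [this]

theorem sum_unifProb_fiber {Ω A : Type*} [Fintype Ω] [Fintype A] (X : Ω → A) (E : Ω → Prop) :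
    ∑ x, unifProb (fun ω => X ω = x ∧ E ω) = unifProb E := by
  classical
  simp only [unifProb_eq_card]
  rw [← Finset.sum_div, ← Nat.cast_sum]
  congr 2
  rw [Finset.card_eq_sum_card_fiberwise (f := X) (t := Finset.univ) (fun _ _ => Finset.mem_univ _)]
  refine Finset.sum_congr rfl fun x _ => ?_
  congr 1
  ext ω
  simp [and_comm]

theorem sum_unifProb_eq_one {Ω A : Type*} [Fintype Ω] [Nonempty Ω] [Fintype A] (X : Ω → A) :
    ∑ x, unifProb (fun ω => X ω = x) = 1 := by
  classical
  have h := sum_unifProb_fiber X (fun _ => True)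
  simp only [and_true] at h
  rw [h, unifProb_eq_card]
  simp

/-- If, whatever the value of `Y`, the law of `X` is uniform on a set of `2 ^ k` points, then
`H(X | Y) = k`. -/
theorem condEntropy_eq_of_uniform {Ω A B : Type*} [Fintype Ω] [Nonempty Ω] [Fintype A] [Fintype B]
    (X : Ω → A) (Y : Ω → B) (k : ℕ)
    (h : ∀ y, ∃ T : Finset A, T.card = 2 ^ k ∧ (∀ ω, Y ω = y → X ω ∈ T) ∧
      ∀ x ∈ T, ∀ x' ∈ T, unifProb (fun ω => X ω = x ∧ Y ω = y) =
        unifProb (fun ω => X ω = x' ∧ Y ω = y)) :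
    condEntropy X Y = k := by
  classical
  unfold condEntropy
  have key : ∀ y : B, unifProb (fun ω => Y ω = y) *
      ∑ x : A, Real.negMulLog
        (unifProb (fun ω => X ω = x ∧ Y ω = y) / unifProb (fun ω => Y ω = y)) / Real.log 2 =
      unifProb (fun ω => Y ω = y) * k := by
    intro y
    obtain ⟨T, hT, hsupp, hunif⟩ := h y
    -- Values of probability zero involve a division by zero, but their weight removes the term.
    by_cases hp : unifProb (fun ω => Y ω = y) = 0
    · rw [hp]; simp
    congr 1
    have hzero : ∀ x, x ∉ T → unifProb (fun ω => X ω = x ∧ Y ω = y) = 0 := by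
      intro x hx
      have : (Finset.univ.filter fun ω => X ω = x ∧ Y ω = y) = ∅ := by
        rw [Finset.filter_eq_empty_iff]
        rintro ω - ⟨h1, h2⟩
        exact hx (h1 ▸ hsupp ω h2)
      rw [unifProb_eq_card, this]; simp
    have hq : ∀ x ∈ T, unifProb (fun ω => X ω = x ∧ Y ω = y) / unifProb (fun ω => Y ω = y) =
        ((2 : ℝ) ^ k)⁻¹ := by
      intro x hx
      have hsum := sum_unifProb_fiber X (fun ω => Y ω = y)
      rw [← Finset.sum_subset (Finset.subset_univ T) (fun x _ hx => hzero x hx),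
        Finset.sum_congr rfl (fun x' hx' => hunif x' hx' x hx), Finset.sum_const, hT,
        nsmul_eq_mul] at hsum
      push_cast at hsum
      have h2 : (2 : ℝ) ^ k ≠ 0 := by positivity
      rw [div_eq_iff hp, ← hsum]
      field_simp
    rw [← Finset.sum_subset (Finset.subset_univ T)]
    · rw [Finset.sum_congr rfl (fun x hx => by rw [hq x hx]), Finset.sum_const, hT, nsmul_eq_mul,
        Real.negMulLog, Real.log_inv, Real.log_pow]
      have hl : Real.log 2 ≠ 0 := (Real.log_pos one_lt_two).ne'
      push_cast
      field_simp
    · intro x _ hx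
      rw [hzero x hx]; simp
  rw [Finset.sum_congr rfl fun y _ => key y, ← Finset.sum_mul, sum_unifProb_eq_one, one_mul]

theorem card_agreeing_functions {ι : Type*} [Fintype ι] [DecidableEq ι] (p : ι → Prop)
    [DecidablePred p] (c : ι → ZMod 2) :
    (Finset.univ.filter fun x : ι → ZMod 2 => ∀ i, ¬ p i → x i = c i).card =
      2 ^ (Finset.univ.filter p).card := by
  have : (Finset.univ.filter fun x : ι → ZMod 2 => ∀ i, ¬ p i → x i = c i) =
      Fintype.piFinset fun i => if p i then Finset.univ else {c i} := by
    ext x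
    simp only [Finset.mem_filter, Finset.mem_univ, true_and, Fintype.mem_piFinset]
    refine forall_congr' fun i => ?_
    by_cases h : p i <;> simp [h]
  rw [this, Fintype.card_piFinset]
  have h2 : ∀ i, (if p i then (Finset.univ : Finset (ZMod 2)) else {c i}).card =
      if p i then 2 else 1 := by
    intro i
    split_ifs <;> simp [ZMod.card]
  rw [Finset.prod_congr rfl fun i _ => h2 i, Finset.prod_ite]
  simp

/-- The conditional entropy of sums of source bits over disjoint supports, given the bits in `B`,
is the number of supports that are not contained in `B`. -/
theorem condEntropy_disjoint_sums {s : ℕ} {ι : Type*} [Fintype ι] [DecidableEq ι]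
    (S : ι → Finset (Fin s)) (hS : ∀ i j, i ≠ j → Disjoint (S i) (S j)) (B : Finset (Fin s)) :
    condEntropy (fun (ω : SourceWord s) i => ∑ b ∈ S i, ω b) (bitsOf B) =
      ((Finset.univ.filter fun i => ¬ S i ⊆ B).card : ℝ) := by
  classical
  apply condEntropy_eq_of_uniform
  intro y
  -- The values off `B` are irrelevant: `yy` is summed only over supports inside `B`.
  let yy : Fin s → ZMod 2 := fun b => if h : b ∈ B then y ⟨b, h⟩ else 0
  refine ⟨Finset.univ.filter fun x : ι → ZMod 2 => ∀ i, ¬ ¬ S i ⊆ B → x i = ∑ b ∈ S i, yy b,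
    card_agreeing_functions _ _, ?_, ?_⟩
  · rintro ω rfl
    simp only [Finset.mem_filter, Finset.mem_univ, true_and, not_not]
    intro i hi
    refine Finset.sum_congr rfl fun b hb => ?_
    simp [yy, hi hb, bitsOf]
  · intro x hx x' hx'
    simp only [Finset.mem_filter, Finset.mem_univ, true_and, not_not] at hx hx'
    have hr : ∀ i, ∃ f : Fin s → ZMod 2, (∀ b, b ∉ S i → f b = 0) ∧ (∀ b ∈ B, f b = 0) ∧
        ∑ b ∈ S i, f b = x' i - x i := by
      intro i
      by_cases hi : S i ⊆ B
      · exact ⟨0, by simp, by simp, by simp [hx i hi, hx' i hi]⟩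
      · obtain ⟨r, hr, hrB⟩ := Finset.not_subset.1 hi
        refine ⟨Pi.single r (x' i - x i), ?_, ?_, ?_⟩
        · intro b hb
          exact Pi.single_eq_of_ne (by rintro rfl; exact hb hr) _
        · intro b hb
          exact Pi.single_eq_of_ne (by rintro rfl; exact hrB hb) _
        · simp [Pi.single_apply, hr]
    choose f hf1 hf2 hf3 using hr
    -- Translation by `d` maps the words with sums `x` onto those with sums `x'` without changing
    -- the bits in `B`. Disjointness of the supports lets each sum be corrected separately, at one
    -- bit outside `B`.
    let d : Fin s → ZMod 2 := fun b => ∑ i, f i b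
    have hdB : ∀ b ∈ B, d b = 0 := fun b hb => Finset.sum_eq_zero fun i _ => hf2 i b hb
    have hdS : ∀ i, ∑ b ∈ S i, d b = x' i - x i := by
      intro i
      rw [← hf3 i]
      refine Finset.sum_congr rfl fun b hb => ?_
      refine Finset.sum_eq_single_of_mem i (Finset.mem_univ _) fun j _ hj => hf1 j b ?_
      exact fun hbj => Finset.disjoint_left.1 (hS j i hj) hbj hb
    rw [unifProb_eq_card, unifProb_eq_card]
    congr 2
    refine Finset.card_bij (fun ω _ => ω + d) ?_ ?_ ?_
    · intro ω hω
      simp only [Finset.mem_filter, Finset.mem_univ, true_and] at hω ⊢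
      constructor
      · funext i
        simp only [Pi.add_apply, Finset.sum_add_distrib, hdS]
        rw [show ∑ b ∈ S i, ω b = x i from congrFun hω.1 i]
        ring
      · rw [← hω.2]
        funext b
        simp [bitsOf, hdB b b.2]
    · intro a _ b _ h
      exact add_right_cancel h
    · intro ω hω
      simp only [Finset.mem_filter, Finset.mem_univ, true_and] at hω
      refine ⟨ω - d, ?_, sub_add_cancel _ _⟩
      simp only [Finset.mem_filter, Finset.mem_univ, true_and]
      constructor
      · funext i
        simp only [Pi.sub_apply, Finset.sum_sub_distrib, hdS]
        rw [show ∑ b ∈ S i, ω b = x' i from congrFun hω.1 i]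
        ring
      · rw [← hω.2]
        funext b
        simp [bitsOf, hdB b b.2]

theorem bitEntropy_eq_card {s : ℕ} (A B : Finset (Fin s)) :
    bitEntropy A B = ((A \ B).card : ℝ) := by
  have h := condEntropy_disjoint_sums (fun b : A => ({(b : Fin s)} : Finset (Fin s)))
    (by
      intro i j hij
      rw [Finset.disjoint_singleton]
      exact fun h => hij (Subtype.ext h)) B
  simp only [Finset.sum_singleton] at h
  refine h.trans ?_
  congr 1
  rw [← Finset.card_map (Function.Embedding.subtype _)]
  congr 1
  ext b
  simp [and_comm]

theorem condEntropy_messageValue {s : ℕ} (V : Finset (Finset (Fin s)))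
    (hV : ∀ A ∈ V, ∀ A' ∈ V, A ≠ A' → Disjoint A A') (B : Finset (Fin s)) :
    condEntropy (IndexCoding.messageValue V) (bitsOf B) =
      ((V.filter fun A => ¬ A ⊆ B).card : ℝ) := by
  have h := condEntropy_disjoint_sums (fun A : V => (A : Finset (Fin s)))
    (fun i j hij => hV i i.2 j j.2 fun h => hij (Subtype.ext h)) B
  refine h.trans ?_
  congr 1
  rw [← Finset.card_map (Function.Embedding.subtype _)]
  congr 1
  ext A
  simp [and_comm]

/-! ### The DSM+ lower bound for arbitrary codes -/

namespace IndexCoding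

variable {m s : ℕ} (P : IndexCoding m s)

/-- The bits that become known in turn when the decoders decode one after the other, in the order
`σ`, and share their side information and their decoded bits with the later ones. -/
def newBits (σ : Equiv.Perm (Fin m)) (k : Fin m) : Finset (Fin s) :=
  P.demand (σ k) \ (((Finset.Iio k).biUnion fun l => P.demand (σ l)) ∪
    ((Finset.Iic k).biUnion fun l => P.side (σ l)))

/-- All bits that become known to the decoders in this way. -/
def allNewBits (σ : Equiv.Perm (Fin m)) : Finset (Fin s) := Finset.univ.biUnion (P.newBits σ)

variable {P}

theorem mem_newBits {σ : Equiv.Perm (Fin m)} {k : Fin m} {b : Fin s} :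
    b ∈ P.newBits σ k ↔ b ∈ P.demand (σ k) ∧ (∀ l < k, b ∉ P.demand (σ l)) ∧
      ∀ l ≤ k, b ∉ P.side (σ l) := by
  simp [newBits]

theorem mem_allNewBits {σ : Equiv.Perm (Fin m)} {b : Fin s} :
    b ∈ P.allNewBits σ ↔ ∃ k, b ∈ P.newBits σ k := by
  simp [allNewBits]

variable (P) in
-- A bit can be new only at its first demander in the order `σ`, so the sets of new bits are
-- disjoint and their sizes add up.
theorem sum_bitEntropy_eq_card (σ : Equiv.Perm (Fin m)) :
    ∑ k : Fin m, bitEntropy (P.demand (σ k))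
      (((Finset.Iio k).biUnion fun l => P.demand (σ l)) ∪
        ((Finset.Iic k).biUnion fun l => P.side (σ l))) = ((P.allNewBits σ).card : ℝ) := by
  simp only [bitEntropy_eq_card]
  rw [← Nat.cast_sum, allNewBits, Finset.card_biUnion]
  · rfl
  · intro k _ k' _ hkk
    refine Finset.disjoint_left.2 fun b hb hb' => ?_
    rw [mem_newBits] at hb hb'
    rcases lt_or_gt_of_ne hkk with h | h
    · exact hb'.2.1 _ h hb.1
    · exact hb.2.1 _ h hb'.1

/-- Source blocks that are decoded correctly and agree outside `allNewBits σ` and in the codeword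
are equal. -/
theorem eq_of_decoded {n M : ℕ} (C : P.Code n M) (σ : Equiv.Perm (Fin m))
    {ω ω' : Fin n → SourceWord s}
    (hω : ∀ α, C.dec α (C.enc ω) (fun k => bitsOf (P.side α) (ω k)) =
      fun k => bitsOf (P.demand α) (ω k))
    (hω' : ∀ α, C.dec α (C.enc ω') (fun k => bitsOf (P.side α) (ω' k)) =
      fun k => bitsOf (P.demand α) (ω' k))
    (henc : C.enc ω = C.enc ω') (hout : ∀ t, ∀ b ∉ P.allNewBits σ, ω t b = ω' t b) : ω = ω' := by
  have key : ∀ k : Fin m, ∀ t, ∀ b ∈ P.demand (σ k), ω t b = ω' t b := by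
    intro k
    induction k using WellFoundedLT.induction with
    | ind k ih =>
      -- A side information bit of `σ k` that is ever new is new strictly before `k`, since no
      -- decoder up to its place in the order holds it; it is then settled by induction.
      have hside : ∀ t, ∀ b ∈ P.side (σ k), ω t b = ω' t b := by
        intro t b hb
        by_cases hT : b ∈ P.allNewBits σ
        · obtain ⟨l, hl⟩ := mem_allNewBits.1 hT
          rw [mem_newBits] at hl
          rcases lt_or_ge l k with h | h
          · exact ih l h t b hl.1
          · exact absurd hb (hl.2.2 k h)
        · exact hout t b hT
      have h1 := hω (σ k)
      have h2 := hω' (σ k)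
      have h3 : (fun t => bitsOf (P.side (σ k)) (ω t)) = fun t => bitsOf (P.side (σ k)) (ω' t) := by
        funext t b
        exact hside t b b.2
      rw [h3, henc, h2] at h1
      intro t b hb
      exact (congrFun (congrFun h1 t) ⟨b, hb⟩).symm
  funext t b
  by_cases hT : b ∈ P.allNewBits σ
  · obtain ⟨l, hl⟩ := mem_allNewBits.1 hT
    exact key l t b (mem_newBits.1 hl).1
  · exact hout t b hT

/-- By `eq_of_decoded`, the correctly decoded blocks inject into pairs of a codeword and the values
of the bits that are never new. -/
theorem card_le_of_code {n M : ℕ} (C : P.Code n M) (σ : Equiv.Perm (Fin m)) :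
    (1 - C.errorProb) * 2 ^ (n * (P.allNewBits σ).card) ≤ M := by
  classical
  set T := P.allNewBits σ with hT
  let Good : (Fin n → SourceWord s) → Prop := fun ω =>
    ∀ α, C.dec α (C.enc ω) (fun k => bitsOf (P.side α) (ω k)) =
      fun k => bitsOf (P.demand α) (ω k)
  have hcardΩ : Fintype.card (Fin n → SourceWord s) = 2 ^ (n * s) := by
    simp [SourceWord, ZMod.card, ← pow_mul, mul_comm]
  have hgood : (1 - C.errorProb) * 2 ^ (n * s) = ((Finset.univ.filter Good).card : ℝ) := by
    have h1 : C.errorProb = unifProb fun ω => ¬ Good ω :=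
      unifProb_congr fun ω => by simp [Good]
    have h2 := Finset.card_filter_add_card_filter_not (s := Finset.univ) Good
    rw [Finset.card_univ, hcardΩ] at h2
    rw [h1, unifProb_eq_card, hcardΩ]
    have h3 : ((Finset.univ.filter Good).card : ℝ) +
        ((Finset.univ.filter fun ω => ¬ Good ω).card : ℝ) = 2 ^ (n * s) := by exact_mod_cast h2
    have h4 : (2 : ℝ) ^ (n * s) ≠ 0 := by positivity
    push_cast
    field_simp
    linarith
  have hle : (Finset.univ.filter Good).card ≤ 2 ^ (n * (s - T.card)) * M := by
    have := Finset.card_le_card_of_injOn (s := Finset.univ.filter Good)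
      (t := (Finset.univ : Finset ((Fin n → ((Tᶜ : Finset (Fin s)) → ZMod 2)) × Fin M)))
      (fun ω => (fun t b => ω t b, C.enc ω)) (fun _ _ => Finset.mem_coe.2 (Finset.mem_univ _)) ?_
    · refine this.trans (le_of_eq ?_)
      simp [ZMod.card, ← pow_mul, mul_comm]
    · intro ω hω ω' hω' h
      simp only [Finset.coe_filter, Finset.mem_univ, true_and, Set.mem_ofPred_eq] at hω hω'
      simp only [Prod.mk.injEq] at h
      refine eq_of_decoded C σ hω hω' h.2 fun t b hb => ?_
      exact congrFun (congrFun h.1 t) ⟨b, Finset.mem_compl.2 hb⟩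
  have hTs : T.card ≤ s := by simpa using Finset.card_le_univ T
  have hsplit : (2 : ℝ) ^ (n * s) = 2 ^ (n * (s - T.card)) * 2 ^ (n * T.card) := by
    rw [← pow_add, ← mul_add, Nat.sub_add_cancel hTs]
  have hle' : ((Finset.univ.filter Good).card : ℝ) ≤ 2 ^ (n * (s - T.card)) * M := by
    exact_mod_cast hle
  rw [← hgood, hsplit] at hle'
  have hpos : (0 : ℝ) < 2 ^ (n * (s - T.card)) := by positivity
  refine le_of_mul_le_mul_left ?_ hpos
  linarith

theorem card_allNewBits_le_of_achievable {R : ℝ} (hR : P.Achievable R)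
    (σ : Equiv.Perm (Fin m)) : ((P.allNewBits σ).card : ℝ) ≤ R := by
  obtain ⟨M, C, hrate, herr⟩ := hR
  set D : ℝ := ((P.allNewBits σ).card : ℝ) with hD
  by_contra! hlt
  have h1 : ∀ᶠ n in Filter.atTop, (C n).errorProb < 1 / 2 :=
    herr.eventually_lt_const (by norm_num)
  -- With error below `1 / 2` the counting bound loses at most one bit per block. Beyond this block
  -- length the gap `n * (D - R)` exceeds that bit.
  obtain ⟨n₀, hn₀⟩ := exists_nat_gt (1 / (D - R))
  obtain ⟨n, hn, hnn₀, hn1⟩ :=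
    (h1.and ((Filter.eventually_ge_atTop n₀).and (Filter.eventually_gt_atTop 0))).exists
  have hle := card_le_of_code (C n) σ
  have hpow : (0 : ℝ) < 2 ^ (n * (P.allNewBits σ).card) := by positivity
  have hhalf : (2 : ℝ) ^ (n * (P.allNewBits σ).card) / 2 ≤ M n := by nlinarith
  have hlog : (n : ℝ) * D - 1 ≤ Real.logb 2 (M n) := by
    have h2 := Real.logb_le_logb_of_le one_lt_two (by positivity) hhalf
    rw [Real.logb_div (by positivity) (by norm_num), Real.logb_pow,
      Real.logb_self_eq_one one_lt_two] at h2
    push_cast at h2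
    linarith
  have hn0 : (0 : ℝ) < n := by exact_mod_cast hn1
  have hr := hrate n hn1
  rw [div_le_iff₀ hn0] at hr
  have hDR : 0 < D - R := by linarith
  have hn2 : 1 / (D - R) < n := hn₀.trans_le (by exact_mod_cast hnn₀)
  rw [div_lt_iff₀ hDR] at hn2
  nlinarith

theorem dsmPlus_le_of_achievable {R : ℝ} (hR : P.Achievable R) : P.dsmPlus ≤ R := by
  refine ciSup_le fun σ => ?_
  rw [sum_bitEntropy_eq_card]
  exact card_allNewBits_le_of_achievable hR σ

variable (P) in
theorem card_allNewBits_le_dsmPlus (σ : Equiv.Perm (Fin m)) :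
    ((P.allNewBits σ).card : ℝ) ≤ P.dsmPlus := by
  rw [← sum_bitEntropy_eq_card]
  exact le_ciSup (f := fun σ : Equiv.Perm (Fin m) => ∑ k : Fin m, bitEntropy (P.demand (σ k))
      (((Finset.Iio k).biUnion fun l => P.demand (σ l)) ∪
        ((Finset.Iic k).biUnion fun l => P.side (σ l)))) (Set.finite_range _).bddAbove σ

end IndexCoding

/-! ### Zero-error codes from Vandermonde matrices -/

namespace IndexCoding

variable {m s : ℕ} {P : IndexCoding m s}

/-- The Vandermonde matrix of distinct nodes is invertible. The `d A` will be the differences of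
component values that a decoder cannot yet tell apart. -/
theorem coeff_eq_zero_of_power_sums {K κ : Type*} [Field K] (Q : Finset κ) (x d : κ → K)
    (hx : Function.Injective x) (r : ℕ) (hr : Q.card ≤ r)
    (h : ∀ l < r, ∑ A ∈ Q, d A * x A ^ l = 0) : ∀ A ∈ Q, d A = 0 := by
  have e := Q.equivFin
  have h0 : (fun i : Fin Q.card => d (e.symm i)) = 0 := by
    refine Matrix.eq_zero_of_forall_pow_sum_mul_pow_eq_zero
      (f := fun i : Fin Q.card => x (e.symm i)) ?_ ?_
    · intro i j hij
      exact e.symm.injective (Subtype.ext (hx hij))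
    · intro l
      rw [← h l (l.2.trans_le hr), ← Finset.sum_coe_sort Q]
      exact Equiv.sum_comp e.symm (fun A : Q => d A * x A ^ (l : ℕ))
  intro A hA
  simpa using congrFun h0 (e ⟨A, hA⟩)

/-- A zero-error code that sends `r I` Reed-Solomon symbols for the message `U I`, where every
decoder in `I` misses at most `r I` components of `U I`. -/
theorem exists_zero_error_code (U : Finset (Fin m) → Finset (Finset (Fin s)))
    (hdec : ∀ i, ∀ b ∈ P.demand i, ∃ I, i ∈ I ∧ ∃ A ∈ U I, b ∈ A ∧ ∀ b' ∈ A, b' ≠ b →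
      b' ∈ P.side i) (r : Finset (Fin m) → ℕ)
    (hr : ∀ I, ∀ i ∈ I, ((U I).filter fun A => ¬ A ⊆ P.side i).card ≤ r I)
    (n : ℕ) (hn : n ≠ 0) (hs : s ≤ n) :
    ∃ C : P.Code n (2 ^ (n * ∑ I, r I)), C.errorProb = 0 := by
  classical
  have : Fact (Nat.Prime 2) := ⟨Nat.prime_two⟩
  let K := GaloisField 2 n
  have : Finite K := inferInstanceAs (Finite (GaloisField 2 n))
  have : Fintype K := Fintype.ofFinite K
  have hcardK : Fintype.card K = 2 ^ n := by
    rw [← Nat.card_eq_fintype_card]; exact GaloisField.card 2 n hn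
  let e : (Fin n → ZMod 2) ≃ₗ[ZMod 2] K := LinearEquiv.ofFinrankEq _ _ (by
    rw [Module.finrank_fin_fun, GaloisField.finrank 2 hn])
  -- Every set of source bits gets its own node in the field, which requires `2 ^ s ≤ 2 ^ n`.
  obtain ⟨x⟩ : Nonempty (Finset (Fin s) ↪ K) := by
    apply Function.Embedding.nonempty_of_card_le
    rw [hcardK, Fintype.card_finset, Fintype.card_fin]
    exact Nat.pow_le_pow_right (by norm_num) hs
  let v : (Fin n → SourceWord s) → Finset (Fin s) → K := fun ω A => e fun t => ∑ b ∈ A, ω t b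
  let cw : (Fin n → SourceWord s) → ((p : Σ I : Finset (Fin m), Fin (r I)) → K) :=
    fun ω p => ∑ A ∈ U p.1, v ω A * x A ^ (p.2 : ℕ)
  have hdetermined : ∀ i ω ω', cw ω = cw ω' →
      (∀ t, bitsOf (P.side i) (ω t) = bitsOf (P.side i) (ω' t)) →
      ∀ t, bitsOf (P.demand i) (ω t) = bitsOf (P.demand i) (ω' t) := by
    intro i ω ω' hcw hside t
    have hside' : ∀ t, ∀ b ∈ P.side i, ω t b = ω' t b :=
      fun t b hb => congrFun (hside t) ⟨b, hb⟩
    funext ⟨b, hb⟩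
    obtain ⟨I, hiI, A, hA, hbA, hrest⟩ := hdec i b hb
    have hvA : v ω A = v ω' A := by
      have hv : ∀ A ⊆ P.side i, v ω A = v ω' A := by
        intro A hA
        simp only [v]
        congr 1
        funext t
        exact Finset.sum_congr rfl fun b hb => hside' t b (hA hb)
      by_cases hAs : A ⊆ P.side i
      · exact hv A hAs
      · refine sub_eq_zero.1 (coeff_eq_zero_of_power_sums
          ((U I).filter fun A => ¬ A ⊆ P.side i) x (fun A => v ω A - v ω' A) x.injective (r I)
          (hr I i hiI) ?_ A (Finset.mem_filter.2 ⟨hA, hAs⟩))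
        intro l hl
        have h1 : ∑ A ∈ U I, (v ω A - v ω' A) * x A ^ l = 0 := by
          simp only [sub_mul, Finset.sum_sub_distrib]
          exact sub_eq_zero.2 (congrFun hcw ⟨I, ⟨l, hl⟩⟩)
        rw [← h1]
        refine Finset.sum_subset (Finset.filter_subset _ _) fun B hB hB' => ?_
        have : B ⊆ P.side i := by
          by_contra hcon
          exact hB' (Finset.mem_filter.2 ⟨hB, hcon⟩)
        rw [hv B this, sub_self, zero_mul]
    have h2 := congrFun (e.injective hvA) t
    rw [← Finset.add_sum_erase _ _ hbA, ← Finset.add_sum_erase _ _ hbA] at h2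
    have h3 : ∑ b' ∈ A.erase b, ω t b' = ∑ b' ∈ A.erase b, ω' t b' :=
      Finset.sum_congr rfl fun b' hb' =>
        hside' t b' (hrest b' (Finset.mem_of_mem_erase hb') (Finset.ne_of_mem_erase hb'))
    rw [h3] at h2
    exact add_right_cancel h2
  have hcard : Fintype.card ((p : Σ I : Finset (Fin m), Fin (r I)) → K) =
      2 ^ (n * ∑ I, r I) := by
    rw [Fintype.card_fun, hcardK, Fintype.card_sigma, ← pow_mul]
    simp
  let E := Fintype.equivFinOfCardEq hcard
  let C : P.Code n (2 ^ (n * ∑ I, r I)) :=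
    { enc := fun ω => E (cw ω)
      -- The decoder takes any source block consistent with what it sees; `hdetermined` shows that
      -- the choice does not affect its demand.
      dec := fun i w y =>
        if h : ∃ ω, E (cw ω) = w ∧ ∀ t, bitsOf (P.side i) (ω t) = y t then
          fun t => bitsOf (P.demand i) (h.choose t)
        else fun _ _ => 0 }
  refine ⟨C, ?_⟩
  have hno : ∀ ω : Fin n → SourceWord s, ¬ ∃ α,
      C.dec α (C.enc ω) (fun k => bitsOf (P.side α) (ω k)) ≠
        fun k => bitsOf (P.demand α) (ω k) := by
    rintro ω ⟨α, hα⟩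
    apply hα
    have h : ∃ ω', E (cw ω') = E (cw ω) ∧
        ∀ t, bitsOf (P.side α) (ω' t) = bitsOf (P.side α) (ω t) := ⟨ω, rfl, fun _ => rfl⟩
    simp only [C]
    rw [dif_pos h]
    funext t
    exact hdetermined α _ _ (E.injective h.choose_spec.1) h.choose_spec.2 t
  rw [Code.errorProb, unifProb_eq_card, Finset.filter_false_of_mem fun ω _ => hno ω]
  simp

theorem achievable_of_components (U : Finset (Fin m) → Finset (Finset (Fin s)))
    (hdec : ∀ i, ∀ b ∈ P.demand i, ∃ I, i ∈ I ∧ ∃ A ∈ U I, b ∈ A ∧ ∀ b' ∈ A, b' ≠ b →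
      b' ∈ P.side i) (r : Finset (Fin m) → ℕ)
    (hr : ∀ I, ∀ i ∈ I, ((U I).filter fun A => ¬ A ⊆ P.side i).card ≤ r I) :
    P.Achievable ((∑ I, r I : ℕ) : ℝ) := by
  classical
  have hC : ∀ n, ∃ C : P.Code n (2 ^ (n * ∑ I, r I)), (n ≠ 0 ∧ s ≤ n) → C.errorProb = 0 := by
    intro n
    by_cases h : n ≠ 0 ∧ s ≤ n
    · obtain ⟨C, hC⟩ := exists_zero_error_code U hdec r hr n h.1 h.2
      exact ⟨C, fun _ => hC⟩
    -- For short blocks an arbitrary code of the same size does: the rate bound still holds and the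
    -- limit ignores it.
    · exact ⟨⟨fun _ => ⟨0, by positivity⟩, fun _ _ _ _ _ => 0⟩, fun h' => absurd h' h⟩
  choose C hC using hC
  refine ⟨_, C, fun n hn => ?_, ?_⟩
  · have hn0 : (n : ℝ) ≠ 0 := by exact_mod_cast hn.ne'
    push_cast
    rw [Real.logb_pow, Real.logb_self_eq_one one_lt_two]
    push_cast
    field_simp
    exact le_rfl
  · refine tendsto_const_nhds.congr' ?_
    filter_upwards [Filter.eventually_ge_atTop (s + 1)] with n hn
    exact (hC n ⟨by omega, by omega⟩).symm

end IndexCoding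

/-! ### Independence by mixing two source words -/

/-- The source word that agrees with `ω` on `A` and with `ω'` off `A`. -/
def mixWords {s : ℕ} (A : Finset (Fin s)) (ω ω' : SourceWord s) : SourceWord s :=
  fun b => if b ∈ A then ω b else ω' b

theorem mixWords_mixWords {s : ℕ} (A : Finset (Fin s)) (ω ω' : SourceWord s) :
    mixWords A (mixWords A ω ω') (mixWords A ω' ω) = ω := by
  funext b
  by_cases h : b ∈ A <;> simp [mixWords, h]

/-- An event determined by the bits in `A` and one determined by the bits off `A` are
conditionally independent given any event that is stable under mixing. -/
theorem unifProb_mul_of_mixing {s : ℕ} (A : Finset (Fin s)) (E F G : SourceWord s → Prop)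
    (hE : ∀ ω ω', E (mixWords A ω ω') ↔ E ω) (hF : ∀ ω ω', F (mixWords A ω ω') ↔ F ω')
    (hG : ∀ ω ω', G ω → G ω' → G (mixWords A ω ω')) :
    unifProb (fun ω => E ω ∧ F ω ∧ G ω) * unifProb G =
      unifProb (fun ω => E ω ∧ G ω) * unifProb (fun ω => F ω ∧ G ω) := by
  classical
  simp only [unifProb_eq_card, div_mul_div_comm]
  congr 1
  rw [← Nat.cast_mul, ← Nat.cast_mul, ← Finset.card_product, ← Finset.card_product]
  congr 1
  -- Exchanging the bits off `A` between two words is an involution. It turns a pair with `E`, `F`,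
  -- `G` for the first word and `G` for the second into a pair with `E`, `G` for the first and `F`,
  -- `G` for the second.
  refine Finset.card_nbij' (fun p => (mixWords A p.1 p.2, mixWords A p.2 p.1))
    (fun p => (mixWords A p.1 p.2, mixWords A p.2 p.1)) ?_ ?_ ?_ ?_
  · rintro ⟨ω, ω'⟩ h
    simp only [Finset.coe_product, Finset.coe_filter, Finset.mem_univ, true_and, Set.mem_prod,
      Set.mem_ofPred_eq] at h ⊢
    obtain ⟨⟨h1, h2, h3⟩, h4⟩ := h
    exact ⟨⟨(hE _ _).2 h1, hG _ _ h3 h4⟩, (hF _ _).2 h2, hG _ _ h4 h3⟩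
  · rintro ⟨ω, ω'⟩ h
    simp only [Finset.coe_product, Finset.coe_filter, Finset.mem_univ, true_and, Set.mem_prod,
      Set.mem_ofPred_eq] at h ⊢
    obtain ⟨⟨h1, h3⟩, h2, h4⟩ := h
    exact ⟨⟨(hE _ _).2 h1, (hF _ _).2 h2, hG _ _ h3 h4⟩, hG _ _ h4 h3⟩
  · rintro ⟨ω, ω'⟩ _
    simp [mixWords_mixWords]
  · rintro ⟨ω, ω'⟩ _
    simp [mixWords_mixWords]

theorem unifProb_and_of_mixing {s : ℕ} (A : Finset (Fin s)) (E F : SourceWord s → Prop)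
    (hE : ∀ ω ω', E (mixWords A ω ω') ↔ E ω) (hF : ∀ ω ω', F (mixWords A ω ω') ↔ F ω') :
    unifProb (fun ω => E ω ∧ F ω) = unifProb E * unifProb F := by
  have h := unifProb_mul_of_mixing A E F (fun _ => True) hE hF (fun _ _ _ _ => trivial)
  have h1 : unifProb (fun _ : SourceWord s => True) = 1 := by
    rw [unifProb_eq_card]; simp
  simpa [h1] using h

namespace IndexCoding

variable {m s : ℕ} {P : IndexCoding m s}

theorem messageValue_mixWords_of_subset {A : Finset (Fin s)} {V : Finset (Finset (Fin s))}
    (h : ∀ B ∈ V, B ⊆ A) (ω ω' : SourceWord s) :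
    messageValue V (mixWords A ω ω') = messageValue V ω := by
  funext B
  refine Finset.sum_congr rfl fun b hb => ?_
  simp [mixWords, h B B.2 hb]

theorem messageValue_mixWords_of_disjoint {A : Finset (Fin s)} {V : Finset (Finset (Fin s))}
    (h : ∀ B ∈ V, Disjoint B A) (ω ω' : SourceWord s) :
    messageValue V (mixWords A ω ω') = messageValue V ω' := by
  funext B
  refine Finset.sum_congr rfl fun b hb => ?_
  simp [mixWords, Finset.disjoint_left.1 (h B B.2) hb]

/-- A selection all of whose components have disjoint supports, and in which every demanded bit
can be read off from one component that the decoder receives, is admissible. -/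
theorem feasible_of_disjoint (U : Finset (Fin m) → Finset (Finset (Fin s)))
    (hdec : ∀ i, ∀ b ∈ P.demand i, ∃ I, i ∈ I ∧ ∃ A ∈ U I, b ∈ A ∧ ∀ b' ∈ A, b' ≠ b →
      b' ∈ P.side i)
    (hdisj : ∀ I J, I ≠ J → ∀ A ∈ U I, ∀ B ∈ U J, Disjoint A B) : P.Feasible U := by
  classical
  have hsub : ∀ (𝒥 : Finset (Finset (Fin m))), ∀ I ∈ 𝒥, ∀ B ∈ U I,
      B ⊆ 𝒥.biUnion fun J => (U J).biUnion id := by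
    intro 𝒥 I hI B hB b hb
    exact Finset.mem_biUnion.2 ⟨I, hI, Finset.mem_biUnion.2 ⟨B, hB, hb⟩⟩
  have hdis : ∀ (𝒥 : Finset (Finset (Fin m))), ∀ I ∉ 𝒥, ∀ B ∈ U I,
      Disjoint B (𝒥.biUnion fun J => (U J).biUnion id) := by
    intro 𝒥 I hI B hB
    rw [Finset.disjoint_biUnion_right]
    intro J hJ
    rw [Finset.disjoint_biUnion_right]
    exact fun A hA => hdisj I J (fun h => hI (h ▸ hJ)) B hB A hA
  refine ⟨fun i => ?_, fun u => ?_, ?_⟩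
  · have hdet : ∀ ω ω' : SourceWord s,
        messageValues U (Finset.univ.filter fun I : Finset (Fin m) => i ∈ I) ω =
          messageValues U (Finset.univ.filter fun I : Finset (Fin m) => i ∈ I) ω' →
        bitsOf (P.side i) ω = bitsOf (P.side i) ω' →
        bitsOf (P.demand i) ω = bitsOf (P.demand i) ω' := by
      intro ω ω' h1 h2
      funext ⟨b, hb⟩
      obtain ⟨I, hiI, A, hA, hbA, hrest⟩ := hdec i b hb
      have h3 : ∑ b ∈ A, ω b = ∑ b ∈ A, ω' b :=
        congrFun (congrFun h1 ⟨I, Finset.mem_filter.2 ⟨Finset.mem_univ _, hiI⟩⟩) ⟨A, hA⟩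
      rw [← Finset.add_sum_erase _ _ hbA, ← Finset.add_sum_erase _ _ hbA] at h3
      have h4 : ∑ b' ∈ A.erase b, ω b' = ∑ b' ∈ A.erase b, ω' b' :=
        Finset.sum_congr rfl fun b' hb' => congrFun h2
          ⟨b', hrest b' (Finset.mem_of_mem_erase hb') (Finset.ne_of_mem_erase hb')⟩
      rw [h4] at h3
      exact add_right_cancel h3
    refine ⟨fun μ y => if h : ∃ ω, messageValues U _ ω = μ ∧ bitsOf (P.side i) ω = y then
      bitsOf (P.demand i) h.choose else 0, fun ω => ?_⟩
    have h : ∃ ω', messageValues U (Finset.univ.filter fun I : Finset (Fin m) => i ∈ I) ω' =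
        messageValues U (Finset.univ.filter fun I : Finset (Fin m) => i ∈ I) ω ∧
        bitsOf (P.side i) ω' = bitsOf (P.side i) ω := ⟨ω, rfl, rfl⟩
    simp only
    rw [dif_pos h]
    exact hdet _ _ h.choose_spec.1 h.choose_spec.2
  · have key : ∀ 𝒥 : Finset (Finset (Fin m)),
        unifProb (fun ω : SourceWord s => ∀ I ∈ 𝒥, messageValue (U I) ω = u I) =
          ∏ I ∈ 𝒥, unifProb (fun ω : SourceWord s => messageValue (U I) ω = u I) := by
      intro 𝒥
      induction 𝒥 using Finset.induction_on with
      | empty => rw [unifProb_eq_card]; simp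
      | insert J 𝒥 hJ ih =>
        rw [Finset.prod_insert hJ, ← ih, mul_comm, ← unifProb_and_of_mixing
          (𝒥.biUnion fun J => (U J).biUnion id)]
        · refine unifProb_congr fun ω => ?_
          rw [Finset.forall_mem_insert, and_comm]
        · intro ω ω'
          refine forall₂_congr fun I hI => ?_
          rw [messageValue_mixWords_of_subset (hsub 𝒥 I hI)]
        · intro ω ω'
          rw [messageValue_mixWords_of_disjoint (hdis 𝒥 J hJ)]
    simpa using key Finset.univ
  · intro 𝒥 𝒦 ℒ T h𝒥𝒦 x z w
    refine unifProb_mul_of_mixing (𝒥.biUnion fun J => (U J).biUnion id) _ _ _ ?_ ?_ ?_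
    · intro ω ω'
      have : messageValues U 𝒥 (mixWords (𝒥.biUnion fun J => (U J).biUnion id) ω ω') =
          messageValues U 𝒥 ω := by
        funext I
        exact messageValue_mixWords_of_subset (hsub 𝒥 I I.2) ω ω'
      rw [this]
    · intro ω ω'
      have : messageValues U 𝒦 (mixWords (𝒥.biUnion fun J => (U J).biUnion id) ω ω') =
          messageValues U 𝒦 ω' := by
        funext I
        exact messageValue_mixWords_of_disjoint
          (hdis 𝒥 I fun h => Finset.disjoint_left.1 h𝒥𝒦 h I.2) ω ω'
      rw [this]
    -- Each message and each side information bit in the condition is read wholly from `ω` or wholly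
    -- from `ω'`, and the two words agree on its value.
    · intro ω ω' hω hω'
      rw [Prod.ext_iff] at hω hω' ⊢
      constructor
      · rw [← hω.1]
        funext I
        by_cases hI : (I : Finset (Fin m)) ∈ 𝒥
        · exact messageValue_mixWords_of_subset (hsub 𝒥 I hI) ω ω'
        · exact (messageValue_mixWords_of_disjoint (hdis 𝒥 I hI) ω ω').trans
            (congrFun (hω'.1.trans hω.1.symm) I)
      · rw [← hω.2]
        funext i b
        have h := congrFun (congrFun (hω'.2.trans hω.2.symm) i) b
        simp only [bitsOf] at h ⊢
        simp only [mixWords]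
        split_ifs
        · rfl
        · exact h

end IndexCoding

/-! ### The bits that Step 1 places outside the top message -/

namespace IndexCoding

variable {m s : ℕ} (P : IndexCoding m s)

/-- `b` is demanded by `k` only, and missing at `j` and `k` only. -/
structure IsPairBit (b : Fin s) (j k : Fin m) : Prop where
  ne : j ≠ k
  needers_eq : P.needers b = {k}
  holders_eq : P.holders b = {k, j}ᶜ
  home_eq : P.home b = {j}ᶜ

variable {P}

theorem mem_needers {b : Fin s} {i : Fin m} : i ∈ P.needers b ↔ b ∈ P.demand i := by
  simp [needers]

theorem mem_holders {b : Fin s} {i : Fin m} : i ∈ P.holders b ↔ b ∈ P.side i := by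
  simp [holders]

theorem disjoint_needers_holders (b : Fin s) : Disjoint (P.needers b) (P.holders b) := by
  rw [Finset.disjoint_left]
  intro i h1 h2
  exact Finset.disjoint_left.1 (P.disjoint_demand_side i) (mem_needers.1 h1) (mem_holders.1 h2)

theorem needers_subset_compl (b : Fin s) : P.needers b ⊆ (P.holders b)ᶜ := fun _ hi =>
  Finset.mem_compl.2 (Finset.disjoint_left.1 (disjoint_needers_holders b) hi)

/-- If every bit is held by none, all, all but one or all but two of the decoders, then Step 1
places only the bits demanded by one of the two decoders missing them outside `U_[m]`. -/
theorem exists_isPairBit (hP : ∀ b : Fin s, (P.holders b).card = 0 ∨ (P.holders b).card = m ∨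
      (P.holders b).card + 1 = m ∨ (P.holders b).card + 2 = m) {b : Fin s}
    (hn : (P.needers b).Nonempty) (hh : P.home b ≠ Finset.univ) : ∃ j k, P.IsPairBit b j k := by
  have hc : (P.holders b)ᶜ ≠ Finset.univ := fun h => hh (by rw [home, if_pos h])
  have hhome : P.home b = P.needers b ∪ P.holders b := by rw [home, if_neg hc]
  have hsub := needers_subset_compl (P := P) b
  have hcard : (P.holders b).card + (P.holders b)ᶜ.card = m := by
    rw [Finset.card_add_card_compl, Fintype.card_fin]
  have hpos := (hn.mono hsub).card_pos
  -- The needers form a nonempty subset of the missing set. If all decoders miss the bit, its home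
  -- is the top; if none does, there is no needer. With one missing decoder, or two that both demand
  -- the bit, needers and holders exhaust all decoders. What remains is a pair with a single needer.
  rcases hP b with h | h | h | h
  · exact absurd (by rw [Finset.card_eq_zero.1 h]; simp) hc
  · omega
  · have h1 : P.needers b = (P.holders b)ᶜ :=
      Finset.eq_of_subset_of_card_le hsub (by have := hn.card_pos; omega)
    exact absurd (by rw [hhome, h1, Finset.union_comm, Finset.union_compl]) hh
  · obtain ⟨x, y, hxy, hJ⟩ := Finset.card_eq_two.1 (show (P.holders b)ᶜ.card = 2 by omega)
    have hH : P.holders b = {x, y}ᶜ := by rw [← hJ, compl_compl]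
    rw [hJ] at hsub
    have hcases : P.needers b = {x} ∨ P.needers b = {y} ∨ P.needers b = {x, y} := by
      by_cases h1 : x ∈ P.needers b
      · by_cases h2 : y ∈ P.needers b
        · right; right
          exact hsub.antisymm (by simp [Finset.insert_subset_iff, h1, h2])
        · left
          ext z
          have := @hsub z
          simp only [Finset.mem_insert, Finset.mem_singleton] at this ⊢
          constructor
          · intro hz
            rcases this hz with rfl | rfl
            · rfl
            · exact absurd hz h2
          · rintro rfl; exact h1
      · right; left
        refine Finset.eq_singleton_iff_nonempty_unique_mem.2 ⟨hn, fun z hz => ?_⟩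
        have := hsub hz
        simp only [Finset.mem_insert, Finset.mem_singleton] at this
        rcases this with rfl | rfl
        · exact absurd hz h1
        · rfl
    rcases hcases with h1 | h1 | h1
    · refine ⟨y, x, hxy.symm, h1, hH, ?_⟩
      rw [hhome, h1, hH]
      ext z
      simp only [Finset.mem_union, Finset.mem_singleton, Finset.mem_compl, Finset.mem_insert]
      grind
    · refine ⟨x, y, hxy, h1, by rw [hH, Finset.pair_comm], ?_⟩
      rw [hhome, h1, hH]
      ext z
      simp only [Finset.mem_union, Finset.mem_singleton, Finset.mem_compl, Finset.mem_insert]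
      grind
    · exact absurd (by rw [hhome, h1, hH, Finset.union_compl]) hh

/-! ### Termination of CAPM -/

theorem exists_isLeast_fin {k : ℕ} (p : Fin k → Prop) (h : ∃ i, p i) : ∃ i, IsLeast {j | p j} i := by
  classical
  obtain ⟨i, hi⟩ := h
  have hne : (Finset.univ.filter p).Nonempty := ⟨i, by simpa using hi⟩
  refine ⟨(Finset.univ.filter p).min' hne, ?_, ?_⟩
  · exact (Finset.mem_filter.1 (Finset.min'_mem _ hne)).2
  · intro j hj
    exact Finset.min'_le _ _ (by simpa using hj)

variable (P) in
-- A minimizer of the entropy misses fewer bits of `U_I` than a maximizer, so it has a bit that the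
-- latter lacks. Each move removes a bit from `U_I`, which bounds the number of moves.
theorem exists_move {I : Finset (Fin m)} (hI : I ≠ Finset.univ)
    (U : Finset (Fin m) → Finset (Fin s)) (hU : ¬ P.Balanced I U) :
    ∃ U', P.Move I U U' ∧ (U' I).card < (U I).card := by
  have hne : I.Nonempty := by
    rw [Finset.nonempty_iff_ne_empty]
    rintro rfl
    exact hU fun i hi => absurd hi (Finset.notMem_empty i)
  obtain ⟨i, hi⟩ := exists_isLeast_fin (fun i => i ∈ I ∧ ∀ l ∈ I,
    bitEntropy (U I) (P.side i) ≤ bitEntropy (U I) (P.side l))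
    (Finset.exists_min_image I (fun l => bitEntropy (U I) (P.side l)) hne)
  obtain ⟨j, hj⟩ := exists_isLeast_fin (fun j => j ∈ I ∧ ∀ l ∈ I,
    bitEntropy (U I) (P.side l) ≤ bitEntropy (U I) (P.side j))
    (Finset.exists_max_image I (fun l => bitEntropy (U I) (P.side l)) hne)
  have hlt : bitEntropy (U I) (P.side i) < bitEntropy (U I) (P.side j) := by
    by_contra! hle
    refine hU fun a ha b hb => le_antisymm ?_ ?_
    · exact (hj.1.2 a ha).trans (hle.trans (hi.1.2 b hb))
    · exact (hj.1.2 b hb).trans (hle.trans (hi.1.2 a ha))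
  obtain ⟨b, hb⟩ := exists_isLeast_fin (fun b => b ∈ U I ∧ b ∈ P.side i ∧ b ∉ P.side j) (by
    by_contra! hno
    rw [bitEntropy_eq_card, bitEntropy_eq_card, Nat.cast_lt] at hlt
    refine absurd (Finset.card_le_card fun b hb => ?_) hlt.not_ge
    rw [Finset.mem_sdiff] at hb ⊢
    exact ⟨hb.1, fun h => hb.2 (hno b hb.1 h)⟩)
  obtain ⟨y, hy⟩ : ∃ y, y ∉ I := by
    by_contra! h
    exact hI (Finset.eq_univ_of_forall h)
  obtain ⟨x, hx⟩ := exists_isLeast_fin (fun x => x ∉ I ∧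
      ((∃ y, y ∉ I ∧ (U (insert y I)).Nonempty) → (U (insert x I)).Nonempty)) (by
    by_cases h : ∃ y, y ∉ I ∧ (U (insert y I)).Nonempty
    · obtain ⟨y, h1, h2⟩ := h
      exact ⟨y, h1, fun _ => h2⟩
    · exact ⟨y, hy, fun h' => absurd h' h⟩)
  refine ⟨_, ⟨i, j, b, x, hi, hj, hlt, hb, hx, rfl⟩, ?_⟩
  have hxI : I ≠ insert x I := fun h => hx.1.1 (h ▸ Finset.mem_insert_self x I)
  rw [Function.update_of_ne hxI, Function.update_self]
  exact Finset.card_erase_lt_of_mem hb.1.1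

variable (P) in
theorem exists_moves_balanced {I : Finset (Fin m)} (hI : I ≠ Finset.univ) (n : ℕ) :
    ∀ U : Finset (Fin m) → Finset (Fin s), (U I).card = n →
      ∃ U', Relation.ReflTransGen (P.Move I) U U' ∧ P.Balanced I U' := by
  induction n using Nat.strong_induction_on with
  | _ n ih =>
    intro U hn
    by_cases hU : P.Balanced I U
    · exact ⟨U, .refl, hU⟩
    · obtain ⟨U', h1, h2⟩ := exists_move P hI U hU
      obtain ⟨U'', h3, h4⟩ := ih _ (hn ▸ h2) U' rfl
      exact ⟨U'', .head h1 h3, h4⟩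

variable (P) in
theorem exists_step2 (L : List (Finset (Fin m))) (hL : ∀ I ∈ L, I ≠ Finset.univ) :
    ∀ U, ∃ W, P.Step2 L U W := by
  induction L with
  | nil => exact fun U => ⟨U, .nil U⟩
  | cons I L ih =>
    intro U
    obtain ⟨U', h1, h2⟩ := exists_moves_balanced P (hL I List.mem_cons_self) _ U rfl
    obtain ⟨W, hW⟩ := ih (fun J hJ => hL J (List.mem_cons_of_mem _ hJ)) U'
    exact ⟨W, .cons _ _ _ _ _ h1 h2 hW⟩

theorem exists_isLevelOrder (m : ℕ) : ∃ L : List (Finset (Fin m)), IsLevelOrder L := by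
  classical
  let r : Finset (Fin m) → Finset (Fin m) → Prop := fun I J => I.card ≤ J.card
  have : Std.Total r := ⟨fun I J => le_total I.card J.card⟩
  have : IsTrans (Finset (Fin m)) r := ⟨fun _ _ _ h h' => le_trans h h'⟩
  refine ⟨((Finset.univ.erase Finset.univ).toList).insertionSort r, ?_, ?_, ?_⟩
  · exact (List.perm_insertionSort r _).nodup_iff.2 (Finset.nodup_toList _)
  · intro I
    rw [(List.perm_insertionSort r _).mem_iff]
    simp
  · exact List.pairwise_insertionSort r _

theorem XorStep.length_lt {L L' : List (Component m s)} (h : XorStep L L') :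
    L'.length < L.length := by
  obtain ⟨i, j, hij, hj, -, -, rfl⟩ := h
  rw [List.length_eraseIdx_of_lt (by simpa using hj)]
  simp only [List.length_set]
  omega

theorem exists_terminal_xorSteps (n : ℕ) : ∀ L : List (Component m s), L.length = n →
    ∃ L', Relation.ReflTransGen XorStep L L' ∧ ∀ L'', ¬ XorStep L' L'' := by
  induction n using Nat.strong_induction_on with
  | _ n ih =>
    intro L hn
    by_cases h : ∃ L', XorStep L L'
    · obtain ⟨L', h1⟩ := h
      obtain ⟨L'', h2, h3⟩ := ih _ (hn ▸ h1.length_lt) L' rfl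
      exact ⟨L'', .head h1 h2, h3⟩
    · exact ⟨L, .refl, fun L' h' => h ⟨L', h'⟩⟩

variable (P) in
theorem exists_isCAPMOutcome : ∃ U, P.IsCAPMOutcome U := by
  obtain ⟨order, horder⟩ := exists_isLevelOrder m
  obtain ⟨W, hW⟩ := exists_step2 P order (fun I hI => (horder.2.1 I).1 hI) P.step1
  choose L hL hterm using fun I => exists_terminal_xorSteps _ ((P.excess W I).toList.map P.ofBit) rfl
  exact ⟨fun I => (W I \ P.excess W I).image (fun b => {b}) ∪
      ((L I).map Component.support).toFinset, order, W, horder, hW, fun I =>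
    ⟨_, L I, Finset.nodup_toList _, Finset.toList_toFinset _, hL I, hterm I, rfl⟩⟩

/-! ### The messages after Step 2 -/

variable (P) in
/-- The placements that Step 2 can produce under the assumption on the side information: bits move
only to `U_[m]`. -/
structure IsPlacement (U : Finset (Fin m) → Finset (Fin s)) : Prop where
  subset_step1 : ∀ I, I ≠ Finset.univ → U I ⊆ P.step1 I
  mem_univ : ∀ b, b ∈ U Finset.univ ↔
    (P.needers b).Nonempty ∧ (P.home b = Finset.univ ∨ b ∉ U (P.home b))

theorem mem_step1 {b : Fin s} {I : Finset (Fin m)} :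
    b ∈ P.step1 I ↔ (P.needers b).Nonempty ∧ P.home b = I := by
  simp [step1]

variable (P) in
theorem isPlacement_step1 : P.IsPlacement P.step1 := by
  refine ⟨fun I _ => Finset.Subset.refl _, fun b => ?_⟩
  simp only [mem_step1]
  tauto

theorem IsPlacement.home_eq {U : Finset (Fin m) → Finset (Fin s)} (hU : P.IsPlacement U)
    {I : Finset (Fin m)} (hI : I ≠ Finset.univ) {b : Fin s} (hb : b ∈ U I) : P.home b = I :=
  (mem_step1.1 (hU.subset_step1 I hI hb)).2

theorem IsPlacement.nonempty {U : Finset (Fin m) → Finset (Fin s)} (hU : P.IsPlacement U)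
    {I : Finset (Fin m)} {b : Fin s} (hb : b ∈ U I) : (P.needers b).Nonempty := by
  by_cases hI : I = Finset.univ
  · subst hI
    exact ((hU.mem_univ b).1 hb).1
  · exact (mem_step1.1 (hU.subset_step1 I hI hb)).1

theorem IsPlacement.disjoint {U : Finset (Fin m) → Finset (Fin s)} (hU : P.IsPlacement U)
    {I J : Finset (Fin m)} (hIJ : I ≠ J) : Disjoint (U I) (U J) := by
  rw [Finset.disjoint_left]
  intro b hI hJ
  by_cases h1 : I = Finset.univ
  · subst h1
    have h := hU.home_eq hIJ.symm hJ
    rcases ((hU.mem_univ b).1 hI).2 with h2 | h2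
    · exact hIJ (h2.symm.trans h)
    · exact h2 (h ▸ hJ)
  by_cases h2 : J = Finset.univ
  · subst h2
    have h := hU.home_eq hIJ hI
    rcases ((hU.mem_univ b).1 hJ).2 with h2 | h2
    · exact hIJ (h.symm.trans h2)
    · exact h2 (h ▸ hI)
  exact hIJ ((hU.home_eq h1 hI).symm.trans (hU.home_eq h2 hJ))

/-- A nonempty message below the top is indexed by the complement of one decoder, so the index `x`
to add is forced and the bit lands in `U_[m]`. -/
theorem Move.isPlacement (hP : ∀ b : Fin s, (P.holders b).card = 0 ∨ (P.holders b).card = m ∨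
      (P.holders b).card + 1 = m ∨ (P.holders b).card + 2 = m) {I : Finset (Fin m)}
    (hI : I ≠ Finset.univ) {U U' : Finset (Fin m) → Finset (Fin s)} (h : P.Move I U U')
    (hU : P.IsPlacement U) :
    P.IsPlacement U' ∧ ∀ J, J ≠ I → J ≠ Finset.univ → U' J = U J := by
  obtain ⟨i, j, b, x, -, -, -, hb, hx, rfl⟩ := h
  have hbI := hb.1.1
  have hhome := hU.home_eq hI hbI
  obtain ⟨j', k, hjk⟩ := exists_isPairBit hP (hU.nonempty hbI) (hhome ▸ hI)
  have hIj : I = {j'}ᶜ := hhome.symm.trans hjk.home_eq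
  have hxj : x = j' := by
    have := hx.1.1
    rw [hIj] at this
    simpa using this
  have hins : insert x I = Finset.univ := by
    rw [hIj, hxj]
    ext z
    simp
  rw [hins]
  have h1 : ∀ J, J ≠ I → J ≠ Finset.univ → Function.update
      (Function.update U I ((U I).erase b)) Finset.univ (insert b (U Finset.univ)) J = U J := by
    intro J h1 h2
    rw [Function.update_of_ne h2, Function.update_of_ne h1]
  have h2 : Function.update (Function.update U I ((U I).erase b)) Finset.univ
      (insert b (U Finset.univ)) I = (U I).erase b := by
    rw [Function.update_of_ne hI, Function.update_self]
  refine ⟨⟨fun J hJ => ?_, fun c => ?_⟩, h1⟩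
  · by_cases hJI : J = I
    · subst hJI
      rw [h2]
      exact (Finset.erase_subset _ _).trans (hU.subset_step1 J hJ)
    · rw [h1 J hJI hJ]
      exact hU.subset_step1 J hJ
  · rw [Function.update_self, Finset.mem_insert, hU.mem_univ]
    by_cases hcu : P.home c = Finset.univ
    · have : c ≠ b := by
        rintro rfl
        exact hI (hhome.symm.trans hcu)
      simp [hcu, this]
    by_cases hcI : P.home c = I
    · rw [hcI, h2, Finset.mem_erase]
      have := hU.nonempty hbI
      by_cases hcb : c = b
      · subst hcb
        simp [this]
      · simp [hcb]
    · rw [h1 _ hcI hcu]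
      have : c ≠ b := by
        rintro rfl
        exact hcI hhome
      simp [this]

theorem moves_isPlacement (hP : ∀ b : Fin s, (P.holders b).card = 0 ∨ (P.holders b).card = m ∨
      (P.holders b).card + 1 = m ∨ (P.holders b).card + 2 = m) {I : Finset (Fin m)}
    (hI : I ≠ Finset.univ) {U U' : Finset (Fin m) → Finset (Fin s)}
    (h : Relation.ReflTransGen (P.Move I) U U') (hU : P.IsPlacement U) :
    P.IsPlacement U' ∧ ∀ J, J ≠ I → J ≠ Finset.univ → U' J = U J := by
  induction h with
  | refl => exact ⟨hU, fun _ _ _ => rfl⟩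
  | tail _ h ih =>
    obtain ⟨h1, h2⟩ := h.isPlacement hP hI ih.1
    exact ⟨h1, fun J hJ hJ' => (h2 J hJ hJ').trans (ih.2 J hJ hJ')⟩

theorem Balanced.congr {I : Finset (Fin m)} {U U' : Finset (Fin m) → Finset (Fin s)}
    (h : P.Balanced I U) (hU : U' I = U I) : P.Balanced I U' := by
  intro i hi j hj
  rw [hU]
  exact h i hi j hj

/-- Moves at one message change only it and `U_[m]`, so a message once balanced stays balanced,
whatever the order of treatment. -/
theorem Step2.isPlacement (hP : ∀ b : Fin s, (P.holders b).card = 0 ∨ (P.holders b).card = m ∨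
      (P.holders b).card + 1 = m ∨ (P.holders b).card + 2 = m) {L : List (Finset (Fin m))}
    {U W : Finset (Fin m) → Finset (Fin s)} (h : P.Step2 L U W) (hL : L.Nodup)
    (hLu : ∀ I ∈ L, I ≠ Finset.univ) (hU : P.IsPlacement U) :
    P.IsPlacement W ∧ (∀ J, J ∉ L → J ≠ Finset.univ → W J = U J) ∧ ∀ I ∈ L, P.Balanced I W := by
  induction h with
  | nil U => exact ⟨hU, fun _ _ _ => rfl, fun I hI => absurd hI List.not_mem_nil⟩
  | cons I L U U' U'' hmoves hbal _ ih =>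
    have hI := hLu I List.mem_cons_self
    obtain ⟨h1, h2⟩ := moves_isPlacement hP hI hmoves hU
    obtain ⟨hIL, hL'⟩ := List.nodup_cons.1 hL
    obtain ⟨h3, h4, h5⟩ := ih hL' (fun J hJ => hLu J (List.mem_cons_of_mem _ hJ)) h1
    refine ⟨h3, fun J hJ hJu => ?_, fun J hJ => ?_⟩
    · rw [List.mem_cons, not_or] at hJ
      rw [h4 J hJ.2 hJu, h2 J hJ.1 hJu]
    · rcases List.mem_cons.1 hJ with rfl | hJ
      · exact hbal.congr (h4 _ hIL hI)
      · exact h5 J hJ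

end IndexCoding

/-! ### The greedy combination of excess bits in Step 3 -/

namespace IndexCoding

variable {m s : ℕ} (P : IndexCoding m s)

/-- A component that sums bits each of which is private to one decoder and known to all other
decoders that demand a bit of the component. -/
structure Component.IsClean (V : Component m s) : Prop where
  nonempty : V.support.Nonempty
  pairBit : ∀ b ∈ V.support, ∃ j k, P.IsPairBit b j k
  home_eq : ∀ b ∈ V.support, P.home b = V.origin
  needers_subset : ∀ b ∈ V.support, ∀ b' ∈ V.support, b ≠ b' → P.needers b ⊆ P.holders b'
  mem_need : ∀ k, k ∈ V.need ↔ ∃ b ∈ V.support, k ∈ P.needers b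
  mem_held : ∀ k, k ∈ V.held ↔ ∀ b ∈ V.support, k ∈ P.holders b

variable {P}

namespace Component.IsClean

variable {V W : Component m s}

theorem need_nonempty (hV : V.IsClean P) : V.need.Nonempty := by
  obtain ⟨b, hb⟩ := hV.nonempty
  obtain ⟨j, k, h⟩ := hV.pairBit b hb
  exact ⟨k, (hV.mem_need k).2 ⟨b, hb, by simp [h.needers_eq]⟩⟩

theorem disjoint_need (hV : V.IsClean P) (h : V.Compatible W) : Disjoint V.need W.need := by
  rw [Finset.disjoint_left]
  intro k hk hk'
  obtain ⟨b, hb, hkb⟩ := (hV.mem_need k).1 hk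
  exact Finset.disjoint_left.1 (disjoint_needers_holders b) hkb
    ((hV.mem_held k).1 (h.2.1 hk') b hb)

/-- A common origin `{j}ᶜ` means that each bit is missing only at `j` and at its own demander, so a
demander of another bit has it. -/
theorem need_subset_held (hV : V.IsClean P) (hW : W.IsClean P) (ho : V.origin = W.origin)
    (h : Disjoint V.need W.need) : V.need ⊆ W.held := by
  intro k hk
  rw [hW.mem_held]
  intro b' hb'
  obtain ⟨b, hb, hkb⟩ := (hV.mem_need k).1 hk
  obtain ⟨j, k₁, h₁⟩ := hV.pairBit b hb
  obtain ⟨j', k₂, h₂⟩ := hW.pairBit b' hb'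
  have hk1 : k = k₁ := by simpa [h₁.needers_eq] using hkb
  subst hk1
  have hj : j = j' := by
    have := (hV.home_eq b hb).trans (ho.trans (hW.home_eq b' hb').symm)
    rw [h₁.home_eq, h₂.home_eq, compl_inj_iff, Finset.singleton_inj] at this
    exact this
  subst hj
  have hk2 : k₂ ∈ W.need := (hW.mem_need k₂).2 ⟨b', hb', by simp [h₂.needers_eq]⟩
  rw [h₂.holders_eq]
  simp only [Finset.mem_compl, Finset.mem_insert, Finset.mem_singleton, not_or]
  exact ⟨fun h' => Finset.disjoint_left.1 h hk (h' ▸ hk2), h₁.ne.symm⟩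

theorem compatible_of_disjoint (hV : V.IsClean P) (hW : W.IsClean P) (ho : V.origin = W.origin)
    (h : Disjoint V.need W.need) : V.Compatible W :=
  ⟨hV.need_subset_held hW ho h, hW.need_subset_held hV ho.symm h.symm, ho⟩

/-- Components with the same origin that cannot be combined have intersecting needs; for a
singleton, intersecting means contained. -/
theorem need_subset_of_singleton (hV : V.IsClean P) (hW : W.IsClean P) (ho : V.origin = W.origin)
    (h : ¬ V.Compatible W) (hs : ∃ k, W.need = {k}) : W.need ⊆ V.need := by
  obtain ⟨k, hk⟩ := hs
  have h1 : ¬ Disjoint V.need W.need := fun h' => h (hV.compatible_of_disjoint hW ho h')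
  rw [hk, Finset.disjoint_singleton_right, not_not] at h1
  rw [hk, Finset.singleton_subset_iff]
  exact h1

theorem mem_support_xor (hd : Disjoint V.support W.support) {b : Fin s} :
    b ∈ (V.xor W).support ↔ b ∈ V.support ∨ b ∈ W.support := by
  have : (V.xor W).support = V.support ∪ W.support := by
    rw [Component.xor, hd.symmDiff_eq_sup]
    rfl
  rw [this, Finset.mem_union]

theorem xor (hV : V.IsClean P) (hW : W.IsClean P) (hd : Disjoint V.support W.support)
    (h : V.Compatible W) : (V.xor W).IsClean P := by
  refine ⟨?_, ?_, ?_, ?_, ?_, ?_⟩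
  · obtain ⟨b, hb⟩ := hV.nonempty
    exact ⟨b, (mem_support_xor hd).2 (.inl hb)⟩
  · intro b hb
    rcases (mem_support_xor hd).1 hb with hb | hb
    · exact hV.pairBit b hb
    · exact hW.pairBit b hb
  · intro b hb
    rcases (mem_support_xor hd).1 hb with hb | hb
    · exact hV.home_eq b hb
    · exact (hW.home_eq b hb).trans h.2.2.symm
  · intro b hb b' hb' hne
    rcases (mem_support_xor hd).1 hb with hb | hb <;>
      rcases (mem_support_xor hd).1 hb' with hb' | hb'
    · exact hV.needers_subset b hb b' hb' hne
    · exact fun k hk => (hW.mem_held k).1 (h.1 ((hV.mem_need k).2 ⟨b, hb, hk⟩)) b' hb'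
    · exact fun k hk => (hV.mem_held k).1 (h.2.1 ((hW.mem_need k).2 ⟨b, hb, hk⟩)) b' hb'
    · exact hW.needers_subset b hb b' hb' hne
  · intro k
    simp only [mem_support_xor hd]
    simp only [Component.xor, Finset.mem_union, hV.mem_need, hW.mem_need]
    grind
  · intro k
    simp only [mem_support_xor hd]
    simp only [Component.xor, Finset.mem_inter, hV.mem_held, hW.mem_held]
    grind

theorem ofBit {b : Fin s} {j k : Fin m} (h : P.IsPairBit b j k) : (P.ofBit b).IsClean P where
  nonempty := ⟨b, Finset.mem_singleton_self b⟩
  pairBit := by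
    intro b' hb'
    rw [Finset.mem_singleton.1 hb']
    exact ⟨j, k, h⟩
  home_eq := by
    intro b' hb'
    rw [Finset.mem_singleton.1 hb']
    rfl
  needers_subset := by
    intro b₁ h₁ b₂ h₂ hne
    exact absurd ((Finset.mem_singleton.1 h₁).trans (Finset.mem_singleton.1 h₂).symm) hne
  mem_need := by simp [IndexCoding.ofBit]
  mem_held := by simp [IndexCoding.ofBit]

end Component.IsClean

variable (P) in
/-- The lists of components that Step 3 can produce from the bits in `B`: after some first
positions, whose components contain the needs of all later ones with the same origin, and one
further component, there are only single bits. -/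
structure IsXorState (B : Finset (Fin s)) (L : List (Component m s)) : Prop where
  clean : ∀ (p : ℕ) (V : Component m s), L[p]? = some V → V.IsClean P
  disjoint : ∀ (p q : ℕ) (V W : Component m s), p < q → L[p]? = some V → L[q]? = some W →
    Disjoint V.support W.support
  cover : ∀ b, b ∈ B ↔ ∃ (p : ℕ) (V : Component m s), L[p]? = some V ∧ b ∈ V.support
  greedy : ∃ t, (∀ (q : ℕ) (V : Component m s), t < q → L[q]? = some V → ∃ k, V.need = {k}) ∧
    ∀ (p q : ℕ) (V W : Component m s), p < t → p < q → L[p]? = some V → L[q]? = some W →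
      V.origin = W.origin →
      W.need ⊆ V.need

theorem isXorState_map_ofBit {B : List (Fin s)} (hB : B.Nodup)
    (hpair : ∀ b ∈ B, ∃ j k, P.IsPairBit b j k) : P.IsXorState B.toFinset (B.map P.ofBit) := by
  have hget : ∀ (p : ℕ) (V : Component m s), (B.map P.ofBit)[p]? = some V →
      ∃ b : Fin s, B[p]? = some b ∧ P.ofBit b = V := by
    intro p V h
    simpa [List.getElem?_map] using h
  refine ⟨?_, ?_, ?_, 0, ?_, ?_⟩
  · intro p V h
    obtain ⟨b, hb, rfl⟩ := hget p V h
    obtain ⟨j, k, hjk⟩ := hpair b (List.mem_of_getElem? hb)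
    exact .ofBit hjk
  · intro p q V W hpq hV hW
    obtain ⟨b, hb, rfl⟩ := hget p V hV
    obtain ⟨c, hc, rfl⟩ := hget q W hW
    refine Finset.disjoint_singleton.2 ?_
    rintro rfl
    obtain ⟨h1, -⟩ := List.getElem?_eq_some_iff.1 hb
    exact hpq.ne ((List.getElem?_inj h1 hB).1 (hb.trans hc.symm))
  · intro b
    rw [List.mem_toFinset]
    constructor
    · intro hb
      obtain ⟨p, hp⟩ := List.getElem?_of_mem hb
      exact ⟨p, P.ofBit b, by simp [hp], Finset.mem_singleton_self b⟩
    · rintro ⟨p, V, hV, hb⟩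
      obtain ⟨c, hc, rfl⟩ := hget p V hV
      rw [Finset.mem_singleton.1 hb]
      exact List.mem_of_getElem? hc
  · intro q V _ h
    obtain ⟨b, hb, rfl⟩ := hget q V h
    obtain ⟨j, k, hjk⟩ := hpair b (List.mem_of_getElem? hb)
    exact ⟨k, hjk.needers_eq⟩
  · intro p q V W h
    omega

theorem getElem?_set_eraseIdx {α : Type*} {L : List α} {i j : ℕ} (hij : i < j) (hj : j < L.length)
    (x : α) (q : ℕ) : ((L.set i x).eraseIdx j)[q]? =
      if q = i then some x else L[if q < j then q else q + 1]? := by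
  rw [List.getElem?_eraseIdx]
  by_cases h1 : q < j
  · rw [if_pos h1, if_pos h1, List.getElem?_set]
    by_cases h2 : i = q
    · subst h2
      simp [hij.trans hj]
    · rw [if_neg h2, if_neg fun h => h2 h.symm]
  · rw [if_neg h1, if_neg h1, List.getElem?_set, if_neg (by omega), if_neg (by omega)]

/-- For the greedy clause the threshold becomes `i`. Since no pair starting before `i` is
compatible, every component there already contains the needs of all later ones with its origin.
Combining two of those later components only forms the union of their needs. -/
theorem IsXorState.xorStep {B : Finset (Fin s)} {L L' : List (Component m s)}
    (hL : P.IsXorState B L) (h : XorStep L L') : P.IsXorState B L' := by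
  obtain ⟨i, j, hij, hj, hcomp, hfirst, rfl⟩ := h
  obtain ⟨V₁, hV₁⟩ : ∃ V, L[i]'(hij.trans hj) = V := ⟨_, rfl⟩
  obtain ⟨V₂, hV₂⟩ : ∃ V, L[j] = V := ⟨_, rfl⟩
  rw [hV₁, hV₂] at hcomp ⊢
  have hV₁' : L[i]? = some V₁ := by rw [List.getElem?_eq_getElem (hij.trans hj), hV₁]
  have hV₂' : L[j]? = some V₂ := by rw [List.getElem?_eq_getElem hj, hV₂]
  have hfirst' : ∀ p q V W, p < q → L[p]? = some V → L[q]? = some W → V.Compatible W →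
      i < p ∨ (i = p ∧ j ≤ q) := by
    intro p q V W hpq hV hW hVW
    obtain ⟨hp, rfl⟩ := List.getElem?_eq_some_iff.1 hV
    obtain ⟨hq, rfl⟩ := List.getElem?_eq_some_iff.1 hW
    exact hfirst p q hpq hq hVW
  have hc₁ := hL.clean i V₁ hV₁'
  have hc₂ := hL.clean j V₂ hV₂'
  have hd := hL.disjoint i j V₁ V₂ hij hV₁' hV₂'
  have hget := getElem?_set_eraseIdx hij hj (V₁.xor V₂)
  -- An entry of the new list is the combined component or an old entry, shifted by one from
  -- position `j` on.
  have hcase : ∀ q V, ((L.set i (V₁.xor V₂)).eraseIdx j)[q]? = some V →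
      (q = i ∧ V = V₁.xor V₂) ∨
      (q ≠ i ∧ ∃ q', q' ≠ i ∧ q' ≠ j ∧ (q' = q ∧ q < j ∨ q' = q + 1 ∧ j ≤ q) ∧ L[q']? = some V) := by
    intro q V hq
    rw [hget] at hq
    by_cases h1 : q = i
    · rw [if_pos h1] at hq
      exact .inl ⟨h1, (Option.some.inj hq).symm⟩
    · rw [if_neg h1] at hq
      refine .inr ⟨h1, _, ?_, ?_, ?_, hq⟩ <;> split_ifs <;> omega
  have hxor : ∀ V p, p ≠ i → p ≠ j → L[p]? = some V →
      Disjoint (V₁.xor V₂).support V.support := by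
    intro V p hpi hpj hV
    rw [Finset.disjoint_left]
    intro b hb hbV
    rcases (Component.IsClean.mem_support_xor hd).1 hb with hb | hb
    · rcases lt_or_gt_of_ne hpi with h | h
      · exact Finset.disjoint_left.1 (hL.disjoint _ _ _ _ h hV hV₁') hbV hb
      · exact Finset.disjoint_left.1 (hL.disjoint _ _ _ _ h hV₁' hV) hb hbV
    · rcases lt_or_gt_of_ne hpj with h | h
      · exact Finset.disjoint_left.1 (hL.disjoint _ _ _ _ h hV hV₂') hbV hb
      · exact Finset.disjoint_left.1 (hL.disjoint _ _ _ _ h hV₂' hV) hb hbV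
  refine ⟨?_, ?_, ?_, ?_⟩
  · intro p V hV
    rcases hcase p V hV with ⟨-, rfl⟩ | ⟨-, q', -, -, -, hq'⟩
    · exact hc₁.xor hc₂ hd hcomp
    · exact hL.clean q' V hq'
  · intro p q V W hpq hV hW
    rcases hcase p V hV with ⟨hp, rfl⟩ | ⟨hp, p', hp1, hp2, hp3, hp'⟩ <;>
      rcases hcase q W hW with ⟨hq, rfl⟩ | ⟨hq, q', hq1, hq2, hq3, hq'⟩
    · omega
    · exact hxor W q' hq1 hq2 hq'
    · exact (hxor V p' hp1 hp2 hp').symm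
    · exact hL.disjoint p' q' V W (by omega) hp' hq'
  · intro b
    rw [hL.cover]
    constructor
    · rintro ⟨p, V, hV, hb⟩
      by_cases hpi : p = i
      · refine ⟨i, V₁.xor V₂, by rw [hget, if_pos rfl], ?_⟩
        subst hpi
        rw [hV₁'] at hV
        rw [Component.IsClean.mem_support_xor hd, Option.some.inj hV]
        exact .inl hb
      by_cases hpj : p = j
      · refine ⟨i, V₁.xor V₂, by rw [hget, if_pos rfl], ?_⟩
        subst hpj
        rw [hV₂'] at hV
        rw [Component.IsClean.mem_support_xor hd, Option.some.inj hV]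
        exact .inr hb
      rcases lt_or_gt_of_ne hpj with h | h
      · exact ⟨p, V, by rw [hget, if_neg hpi, if_pos h, hV], hb⟩
      · refine ⟨p - 1, V, ?_, hb⟩
        rw [hget, if_neg (by omega), if_neg (by omega), Nat.sub_add_cancel (by omega), hV]
    · rintro ⟨p, V, hV, hb⟩
      rcases hcase p V hV with ⟨-, rfl⟩ | ⟨-, q', -, -, -, hq'⟩
      · rcases (Component.IsClean.mem_support_xor hd).1 hb with hb | hb
        · exact ⟨i, V₁, hV₁', hb⟩
        · exact ⟨j, V₂, hV₂', hb⟩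
      · exact ⟨q', V, hq', hb⟩
  · obtain ⟨t, ht1, ht2⟩ := hL.greedy
    -- Below `t` the need of a later component with the same origin is contained, while compatible
    -- components have disjoint nonempty needs.
    have hti : t ≤ i := by
      by_contra! hlt
      have h1 := ht2 i j V₁ V₂ hlt hij hV₁' hV₂' hcomp.2.2
      obtain ⟨k, hk⟩ := hc₂.need_nonempty
      exact Finset.disjoint_left.1 (hc₁.disjoint_need hcomp) (h1 hk) hk
    have hold : ∀ (p q : ℕ) (V W : Component m s), p < i → p < q → L[p]? = some V →
        L[q]? = some W → V.origin = W.origin → W.need ⊆ V.need := by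
      intro p q V W hpi hpq hV hW ho
      by_cases hpt : p < t
      · exact ht2 p q V W hpt hpq hV hW ho
      · refine (hL.clean p V hV).need_subset_of_singleton (hL.clean q W hW) ho (fun hVW => ?_)
          (ht1 q W (by omega) hW)
        have := hfirst' p q V W hpq hV hW hVW
        omega
    refine ⟨i, ?_, ?_⟩
    · intro q V hq hV
      rcases hcase q V hV with ⟨hq', -⟩ | ⟨-, q', -, -, h3, hq'⟩
      · omega
      · exact ht1 q' V (by omega) hq'
    · intro p q V W hpi hpq hV hW ho
      rcases hcase p V hV with ⟨hp, -⟩ | ⟨-, p', -, -, hp3, hp'⟩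
      · omega
      obtain rfl : p' = p := by omega
      rcases hcase q W hW with ⟨rfl, rfl⟩ | ⟨-, q', -, -, hq3, hq'⟩
      · refine Finset.union_subset ?_ ?_
        · exact hold p' q V V₁ hpi hpq hp' hV₁' ho
        · exact hold p' j V V₂ hpi (by omega) hp' hV₂' (ho.trans hcomp.2.2)
      · exact hold p' q' V W hpi (by omega) hp' hq' ho

theorem IsXorState.xorSteps {B : Finset (Fin s)} {L L' : List (Component m s)}
    (hL : P.IsXorState B L) (h : Relation.ReflTransGen XorStep L L') : P.IsXorState B L' := by
  induction h with
  | refl => exact hL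
  | tail _ h ih => exact ih.xorStep h

theorem exists_xorStep {L : List (Component m s)} {p q : ℕ} {V W : Component m s} (hpq : p < q)
    (hV : L[p]? = some V) (hW : L[q]? = some W) (h : V.Compatible W) : ∃ L', XorStep L L' := by
  classical
  let R : ℕ → ℕ → Prop := fun p q => ∃ V W, p < q ∧ L[p]? = some V ∧ L[q]? = some W ∧
    V.Compatible W
  have hex : ∃ p, ∃ q, R p q := ⟨p, q, V, W, hpq, hV, hW, h⟩
  -- The two nested minima give the lexicographically first compatible pair.
  obtain ⟨V', W', hlt, hV', hW', hcomp⟩ := Nat.find_spec (Nat.find_spec hex)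
  obtain ⟨_, hV''⟩ := List.getElem?_eq_some_iff.1 hV'
  obtain ⟨hj, hW''⟩ := List.getElem?_eq_some_iff.1 hW'
  refine ⟨_, Nat.find hex, Nat.find (Nat.find_spec hex), hlt, hj, ?_, ?_, rfl⟩
  · rw [hV'', hW'']
    exact hcomp
  · intro i' j' hij' hj' hc
    have hR : R i' j' := ⟨_, _, hij', List.getElem?_eq_getElem _, List.getElem?_eq_getElem _, hc⟩
    rcases (Nat.find_min' hex ⟨j', hR⟩).lt_or_eq with h1 | h1
    · exact .inl h1
    · refine .inr ⟨h1, Nat.find_min' _ ?_⟩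
      rw [h1]
      exact hR

/-- When Step 3 ends, the components with a given origin have a common need. -/
theorem IsXorState.exists_common_need {B : Finset (Fin s)} {L : List (Component m s)}
    (hL : P.IsXorState B L) (hterm : ∀ L', ¬ XorStep L L') (o : Finset (Fin m))
    (hne : ∃ V ∈ L, V.origin = o) : ∃ k, ∀ V ∈ L, V.origin = o → k ∈ V.need := by
  classical
  obtain ⟨t, ht1, ht2⟩ := hL.greedy
  have hnest : ∀ (p q : ℕ) (V W : Component m s), p < q → L[p]? = some V →
      L[q]? = some W → V.origin = W.origin → W.need ⊆ V.need := by
    intro p q V W hpq hV hW ho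
    by_cases hpt : p < t
    · exact ht2 p q V W hpt hpq hV hW ho
    · refine (hL.clean p V hV).need_subset_of_singleton (hL.clean q W hW) ho (fun hVW => ?_)
        (ht1 q W (by omega) hW)
      obtain ⟨L', hL'⟩ := exists_xorStep hpq hV hW hVW
      exact hterm L' hL'
  -- Needs decrease along the positions with origin `o`, so any decoder needed by the last such
  -- component is needed by all.
  let S := (Finset.range L.length).filter fun p => ∃ V, L[p]? = some V ∧ V.origin = o
  have hS : S.Nonempty := by
    obtain ⟨V, hV, ho⟩ := hne
    obtain ⟨p, hp⟩ := List.getElem?_of_mem hV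
    obtain ⟨hpl, -⟩ := List.getElem?_eq_some_iff.1 hp
    exact ⟨p, Finset.mem_filter.2 ⟨Finset.mem_range.2 hpl, V, hp, ho⟩⟩
  obtain ⟨-, W, hW, hWo⟩ := Finset.mem_filter.1 (S.max'_mem hS)
  obtain ⟨k, hk⟩ := (hL.clean _ W hW).need_nonempty
  refine ⟨k, fun V hV ho => ?_⟩
  obtain ⟨p, hp⟩ := List.getElem?_of_mem hV
  obtain ⟨hpl, -⟩ := List.getElem?_eq_some_iff.1 hp
  have hle := S.le_max' p (Finset.mem_filter.2 ⟨Finset.mem_range.2 hpl, V, hp, ho⟩)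
  rcases hle.lt_or_eq with h | h
  · exact hnest p _ V W h hp hW (ho.trans hWo.symm) hk
  · rw [← h, hp] at hW
    rw [Option.some.inj hW]
    exact hk

end IndexCoding

/-! ### The rate of the final selection -/

theorem card_le_card_of_disjoint_of_meets {α : Type*} [DecidableEq α] (F : Finset (Finset α))
    (T : Finset α) (hF : ∀ A ∈ F, ∀ B ∈ F, A ≠ B → Disjoint A B)
    (hT : ∀ A ∈ F, ∃ b ∈ A, b ∈ T) : F.card ≤ T.card := by
  rcases F.eq_empty_or_nonempty with rfl | ⟨A₀, hA₀⟩
  · simp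
  have : Nonempty α := ⟨(hT A₀ hA₀).choose⟩
  choose! f hf1 hf2 using hT
  refine Finset.card_le_card_of_injOn f (fun A hA => hf2 A hA) fun A hA B hB h => ?_
  by_contra hne
  exact Finset.disjoint_left.1 (hF A hA B hB hne) (hf1 A hA) (h ▸ hf1 B hB)

namespace IndexCoding

variable {m s : ℕ} {P : IndexCoding m s}

theorem mem_part {b : Fin s} {I J : Finset (Fin m)} :
    b ∈ P.part I J ↔ P.needers b = I ∧ (P.holders b)ᶜ = J := by
  simp [part]

theorem IsPairBit.mem_part {b : Fin s} {j k : Fin m} (h : P.IsPairBit b j k) :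
    b ∈ P.part {k} {k, j} :=
  IndexCoding.mem_part.2 ⟨h.needers_eq, by rw [h.holders_eq, compl_compl]⟩

variable (P) in
/-- What CAPM ends with: the placement `W` and the final components `L` of the excess bits
of `U_[m]`. -/
structure IsFinalSelection (W : Finset (Fin m) → Finset (Fin s)) (L : List (Component m s))
    (U : Finset (Fin m) → Finset (Finset (Fin s))) : Prop where
  placement : P.IsPlacement W
  balanced : ∀ I, I ≠ Finset.univ → P.Balanced I W
  xorState : P.IsXorState (P.excess W Finset.univ) L
  terminal : ∀ L', ¬ XorStep L L'
  eq_singletons : ∀ I, I ≠ Finset.univ → U I = (W I).image fun b => {b}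
  eq_univ : U Finset.univ = (W Finset.univ \ P.excess W Finset.univ).image (fun b => {b}) ∪
    (L.map Component.support).toFinset

theorem mem_excess {W : Finset (Fin m) → Finset (Fin s)} {I : Finset (Fin m)} {b : Fin s} :
    b ∈ P.excess W I ↔ b ∈ W I ∧ P.home b ≠ I := by
  simp [excess]

theorem IsPlacement.excess_eq_empty {W : Finset (Fin m) → Finset (Fin s)} (hW : P.IsPlacement W)
    {I : Finset (Fin m)} (hI : I ≠ Finset.univ) : P.excess W I = ∅ :=
  Finset.eq_empty_of_forall_notMem fun _ hb =>
    (mem_excess.1 hb).2 (hW.home_eq hI (mem_excess.1 hb).1)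

/-- Only `U_[m]` receives excess bits, so Step 3 leaves every other message as a set of single bits.
-/
theorem IsCAPMOutcome.exists_isFinalSelection
    (hP : ∀ b : Fin s, (P.holders b).card = 0 ∨ (P.holders b).card = m ∨
      (P.holders b).card + 1 = m ∨ (P.holders b).card + 2 = m)
    {U : Finset (Fin m) → Finset (Finset (Fin s))} (h : P.IsCAPMOutcome U) :
    ∃ W L, P.IsFinalSelection W L U := by
  obtain ⟨order, W, horder, hstep, hU⟩ := h
  obtain ⟨hW, -, hbal⟩ := hstep.isPlacement hP horder.1 (fun I hI => (horder.2.1 I).1 hI)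
    (isPlacement_step1 P)
  have hstate : ∀ I, ∃ L, P.IsXorState (P.excess W I) L ∧ (∀ L', ¬ XorStep L L') ∧
      U I = (W I \ P.excess W I).image (fun b => {b}) ∪ (L.map Component.support).toFinset := by
    intro I
    obtain ⟨B, L, hB, hBe, hsteps, hterm, hUI⟩ := hU I
    refine ⟨L, ?_, hterm, hUI⟩
    rw [← hBe]
    refine (isXorState_map_ofBit hB fun b hb => ?_).xorSteps hsteps
    have hbe : b ∈ P.excess W I := hBe ▸ List.mem_toFinset.2 hb
    refine exists_isPairBit hP (hW.nonempty (mem_excess.1 hbe).1) ?_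
    by_cases hI : I = Finset.univ
    · exact hI ▸ (mem_excess.1 hbe).2
    · rw [hW.excess_eq_empty hI] at hbe
      exact absurd hbe (Finset.notMem_empty b)
  obtain ⟨L, hL, hterm, hUL⟩ := hstate Finset.univ
  refine ⟨W, L, hW, fun I hI => hbal I ((horder.2.1 I).2 hI), hL, hterm, fun I hI => ?_, hUL⟩
  obtain ⟨L', hL', -, hU'⟩ := hstate I
  rw [hW.excess_eq_empty hI] at hL' hU'
  have hnil : L' = [] := by
    rw [List.eq_nil_iff_forall_not_mem]
    intro V hV
    obtain ⟨p, hp⟩ := List.getElem?_of_mem hV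
    obtain ⟨b, hb⟩ := (hL'.clean p V hp).nonempty
    exact absurd ((hL'.cover b).2 ⟨p, V, hp, hb⟩) (Finset.notMem_empty b)
  rw [hU', hnil]
  simp

namespace IsFinalSelection

variable {W : Finset (Fin m) → Finset (Fin s)} {L : List (Component m s)}
  {U : Finset (Fin m) → Finset (Finset (Fin s))}

theorem clean (h : P.IsFinalSelection W L U) {V : Component m s} (hV : V ∈ L) : V.IsClean P := by
  obtain ⟨p, hp⟩ := List.getElem?_of_mem hV
  exact h.xorState.clean p V hp

theorem support_subset (h : P.IsFinalSelection W L U) {V : Component m s} (hV : V ∈ L) :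
    V.support ⊆ P.excess W Finset.univ := by
  obtain ⟨p, hp⟩ := List.getElem?_of_mem hV
  exact fun b hb => (h.xorState.cover b).2 ⟨p, V, hp, hb⟩

theorem mem_univ_iff (h : P.IsFinalSelection W L U) {A : Finset (Fin s)} :
    A ∈ U Finset.univ ↔ (∃ b, b ∈ W Finset.univ ∧ P.home b = Finset.univ ∧ A = {b}) ∨
      ∃ V ∈ L, V.support = A := by
  rw [h.eq_univ, Finset.mem_union, Finset.mem_image, List.mem_toFinset, List.mem_map]
  refine or_congr (exists_congr fun b => ?_) Iff.rfl
  rw [Finset.mem_sdiff, mem_excess]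
  grind

theorem mem_iff (h : P.IsFinalSelection W L U) {I : Finset (Fin m)} (hI : I ≠ Finset.univ)
    {A : Finset (Fin s)} : A ∈ U I ↔ ∃ b ∈ W I, {b} = A := by
  rw [h.eq_singletons I hI, Finset.mem_image]

theorem subset_placement (h : P.IsFinalSelection W L U) {I : Finset (Fin m)} {A : Finset (Fin s)}
    (hA : A ∈ U I) : A ⊆ W I := by
  by_cases hI : I = Finset.univ
  · subst hI
    rcases h.mem_univ_iff.1 hA with ⟨b, hb, -, rfl⟩ | ⟨V, hV, rfl⟩
    · exact Finset.singleton_subset_iff.2 hb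
    · exact (h.support_subset hV).trans (Finset.filter_subset _ _)
  · obtain ⟨b, hb, rfl⟩ := (h.mem_iff hI).1 hA
    exact Finset.singleton_subset_iff.2 hb

theorem disjoint_of_ne (h : P.IsFinalSelection W L U) {I J : Finset (Fin m)} (hIJ : I ≠ J)
    {A B : Finset (Fin s)} (hA : A ∈ U I) (hB : B ∈ U J) : Disjoint A B :=
  Finset.disjoint_of_subset_left (h.subset_placement hA)
    (Finset.disjoint_of_subset_right (h.subset_placement hB) (h.placement.disjoint hIJ))

theorem pairwise_disjoint (h : P.IsFinalSelection W L U) (I : Finset (Fin m)) :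
    ∀ A ∈ U I, ∀ B ∈ U I, A ≠ B → Disjoint A B := by
  intro A hA B hB hne
  by_cases hI : I = Finset.univ
  · subst hI
    have hmixed : ∀ b, P.home b = Finset.univ → ∀ V ∈ L, b ∉ V.support := fun b hb V hV hbV =>
      (mem_excess.1 (h.support_subset hV hbV)).2 hb
    rcases h.mem_univ_iff.1 hA with ⟨b, -, hb, rfl⟩ | ⟨V, hV, rfl⟩ <;>
      rcases h.mem_univ_iff.1 hB with ⟨c, -, hc, rfl⟩ | ⟨V', hV', rfl⟩
    · exact Finset.disjoint_singleton.2 fun h => hne (by rw [h])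
    · exact Finset.disjoint_singleton_left.2 (hmixed b hb V' hV')
    · exact Finset.disjoint_singleton_right.2 (hmixed c hc V hV)
    · obtain ⟨p, hp⟩ := List.getElem?_of_mem hV
      obtain ⟨q, hq⟩ := List.getElem?_of_mem hV'
      rcases lt_trichotomy p q with hpq | rfl | hpq
      · exact h.xorState.disjoint p q V V' hpq hp hq
      · rw [hp] at hq
        exact absurd (by rw [Option.some.inj hq]) hne
      · exact (h.xorState.disjoint q p V' V hpq hq hp).symm
  · obtain ⟨b, -, rfl⟩ := (h.mem_iff hI).1 hA
    obtain ⟨c, -, rfl⟩ := (h.mem_iff hI).1 hB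
    exact Finset.disjoint_singleton.2 fun h => hne (by rw [h])

theorem decodable (h : P.IsFinalSelection W L U)
    (hP : ∀ b : Fin s, (P.holders b).card = 0 ∨ (P.holders b).card = m ∨
      (P.holders b).card + 1 = m ∨ (P.holders b).card + 2 = m) :
    ∀ i, ∀ b ∈ P.demand i, ∃ I, i ∈ I ∧ ∃ A ∈ U I, b ∈ A ∧ ∀ b' ∈ A, b' ≠ b →
      b' ∈ P.side i := by
  intro i b hb
  have hin : i ∈ P.needers b := mem_needers.2 hb
  have hsingle : ∀ b' ∈ ({b} : Finset (Fin s)), b' ≠ b → b' ∈ P.side i := fun b' hb' hne =>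
    absurd (Finset.mem_singleton.1 hb') hne
  by_cases hu : b ∈ W Finset.univ
  · refine ⟨Finset.univ, Finset.mem_univ i, ?_⟩
    by_cases hh : P.home b = Finset.univ
    · exact ⟨{b}, h.mem_univ_iff.2 (.inl ⟨b, hu, hh, rfl⟩), Finset.mem_singleton_self b, hsingle⟩
    · obtain ⟨p, V, hp, hbV⟩ := (h.xorState.cover b).1 (mem_excess.2 ⟨hu, hh⟩)
      refine ⟨V.support, h.mem_univ_iff.2 (.inr ⟨V, List.mem_of_getElem? hp, rfl⟩), hbV,
        fun b' hb' hne => ?_⟩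
      exact mem_holders.1 ((h.xorState.clean p V hp).needers_subset b hbV b' hb' hne.symm hin)
  · have hn : (P.needers b).Nonempty := ⟨i, hin⟩
    rw [h.placement.mem_univ] at hu
    have hh : P.home b ≠ Finset.univ := fun hh => hu ⟨hn, .inl hh⟩
    have hbW : b ∈ W (P.home b) := by
      by_contra hcon
      exact hu ⟨hn, .inr hcon⟩
    obtain ⟨j, k, hjk⟩ := exists_isPairBit hP hn hh
    refine ⟨P.home b, ?_, {b}, (h.mem_iff hh).2 ⟨b, hbW, rfl⟩, Finset.mem_singleton_self b,
      hsingle⟩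
    rw [hjk.needers_eq, Finset.mem_singleton] at hin
    rw [hjk.home_eq, hin, Finset.mem_compl, Finset.mem_singleton]
    exact hjk.ne.symm

theorem feasible (h : P.IsFinalSelection W L U)
    (hP : ∀ b : Fin s, (P.holders b).card = 0 ∨ (P.holders b).card = m ∨
      (P.holders b).card + 1 = m ∨ (P.holders b).card + 2 = m) : P.Feasible U :=
  feasible_of_disjoint U (h.decodable hP) fun _ _ hIJ _ hA _ hB => h.disjoint_of_ne hIJ hA hB

end IsFinalSelection

variable (P) in
/-- The largest number of components of `U_I` missing at a decoder in `I`. -/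
def missingCount (U : Finset (Fin m) → Finset (Finset (Fin s))) (I : Finset (Fin m)) : ℕ :=
  I.sup fun i => ((U I).filter fun A => ¬ A ⊆ P.side i).card

namespace IsFinalSelection

variable {W : Finset (Fin m) → Finset (Fin s)} {L : List (Component m s)}
  {U : Finset (Fin m) → Finset (Finset (Fin s))}

theorem messageRate_eq (h : P.IsFinalSelection W L U) :
    P.messageRate U = ((∑ I, P.missingCount U I : ℕ) : ℝ) := by
  rw [messageRate, Nat.cast_sum]
  refine Finset.sum_congr rfl fun I _ => ?_
  simp only [condEntropy_messageValue (U I) (h.pairwise_disjoint I)]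
  rcases I.eq_empty_or_nonempty with rfl | hI
  -- For `I = ∅` both the real supremum and the supremum of naturals default to `0`.
  · rw [missingCount, Finset.sup_empty, Real.iSup_of_isEmpty]
    simp
  · have : Nonempty I := hI.to_subtype
    apply le_antisymm
    · refine ciSup_le fun i => Nat.cast_le.2 ?_
      exact Finset.le_sup (f := fun i => ((U I).filter fun A => ¬ A ⊆ P.side i).card) i.2
    · obtain ⟨i, hi, hsup⟩ := Finset.exists_mem_eq_sup I hI
        (fun i => ((U I).filter fun A => ¬ A ⊆ P.side i).card)
      rw [missingCount, hsup]
      exact le_ciSup (f := fun i : I => (((U I).filter fun A => ¬ A ⊆ P.side i).card : ℝ))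
        (Set.finite_range _).bddAbove ⟨i, hi⟩

/-- By balance the maximum is attained at every decoder in `I`. This freedom to choose `i` is what
Step 2 is for. -/
theorem missingCount_eq (h : P.IsFinalSelection W L U) {I : Finset (Fin m)}
    (hI : I ≠ Finset.univ) {i : Fin m} (hi : i ∈ I) :
    P.missingCount U I = (W I \ P.side i).card := by
  have hcount : ∀ l, ((U I).filter fun A => ¬ A ⊆ P.side l).card = (W I \ P.side l).card := by
    intro l
    rw [h.eq_singletons I hI, Finset.filter_image,
      Finset.card_image_of_injective _ Finset.singleton_injective]
    congr 1
    ext b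
    simp
  have hconst : ∀ l ∈ I, (W I \ P.side l).card = (W I \ P.side i).card := by
    intro l hl
    have := h.balanced I hI l hl i hi
    rw [bitEntropy_eq_card, bitEntropy_eq_card] at this
    exact_mod_cast this
  rw [missingCount]
  apply le_antisymm
  · exact Finset.sup_le fun l hl => by rw [hcount, hconst l hl]
  · rw [← hcount]
    exact Finset.le_sup (f := fun i => ((U I).filter fun A => ¬ A ⊆ P.side i).card) hi

theorem missingCount_eq_zero (h : P.IsFinalSelection W L U) {I : Finset (Fin m)}
    (hI : I ≠ Finset.univ) (hW : W I = ∅) : P.missingCount U I = 0 := by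
  rw [missingCount, h.eq_singletons I hI, hW]
  simp

end IsFinalSelection

variable (P) in
/-- The bits that are missing at exactly `i` and one other decoder, which is the only one to demand
them. -/
def privateBits (i : Fin m) : Finset (Fin s) :=
  (Finset.univ.erase i).biUnion fun k => P.part {k} {i, k}

theorem mem_privateBits {i : Fin m} {b : Fin s} :
    b ∈ P.privateBits i ↔ ∃ k, k ≠ i ∧ b ∈ P.part {k} {i, k} := by
  simp [privateBits]

theorem isPairBit_of_mem_privateBits {i k : Fin m} {b : Fin s} (hki : k ≠ i)
    (hb : b ∈ P.part {k} {i, k}) (hh : P.home b ≠ Finset.univ) : P.IsPairBit b i k := by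
  obtain ⟨h1, h2⟩ := mem_part.1 hb
  have hH : P.holders b = {k, i}ᶜ := by rw [Finset.pair_comm, ← h2, compl_compl]
  refine ⟨hki.symm, h1, hH, ?_⟩
  rw [home] at hh ⊢
  split_ifs at hh ⊢
  · exact absurd rfl hh
  · rw [h1, hH]
    ext z
    simp only [Finset.mem_union, Finset.mem_singleton, Finset.mem_compl, Finset.mem_insert]
    grind

theorem IsPairBit.eq_of_mem_privateBits {i j k : Fin m} {b : Fin s} (h : P.IsPairBit b j k)
    (hb : b ∈ P.privateBits i) : j = i := by
  obtain ⟨k', hk', hb⟩ := mem_privateBits.1 hb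
  obtain ⟨h1, h2⟩ := IndexCoding.mem_part.1 hb
  have hk : k = k' := by
    rw [h.needers_eq] at h1
    exact Finset.singleton_injective h1
  subst hk
  have hj : j ∈ (P.holders b)ᶜ := by rw [h.holders_eq, compl_compl]; simp
  rw [h2, Finset.mem_insert, Finset.mem_singleton] at hj
  exact hj.resolve_right h.ne

variable (P) in
/-- The demanded bits missing at `i` that are not private to another decoder. -/
def missingBits (i : Fin m) : Finset (Fin s) :=
  Finset.univ.filter fun b => (P.needers b).Nonempty ∧ b ∉ P.side i ∧ b ∉ P.privateBits i

theorem mem_missingBits {i : Fin m} {b : Fin s} : b ∈ P.missingBits i ↔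
    (P.needers b).Nonempty ∧ b ∉ P.side i ∧ b ∉ P.privateBits i := by
  simp [missingBits]

theorem mem_reducedDemand {α : Fin m} {b : Fin s} : b ∈ P.reducedDemand α ↔
    b ∈ P.demand α ∧ ∀ β, β ≠ α → b ∉ P.part {α} {α, β} := by
  simp [reducedDemand]

variable (P) in
-- If a bit missing at `i` and demanded by `k ≠ i` lies in some `f_{k{k,β}}`, then `β = i`, so the
-- bit is private and not counted.
theorem missingBits_subset (i : Fin m) :
    P.missingBits i ⊆
      (P.demand i ∪ (Finset.univ.erase i).biUnion P.reducedDemand) \ P.side i := by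
  intro b hb
  obtain ⟨⟨k, hk⟩, hbi, hbp⟩ := mem_missingBits.1 hb
  refine Finset.mem_sdiff.2 ⟨?_, hbi⟩
  rw [Finset.mem_union]
  by_cases hbd : b ∈ P.demand i
  · exact .inl hbd
  right
  have hki : k ≠ i := by
    rintro rfl
    exact hbd (mem_needers.1 hk)
  refine Finset.mem_biUnion.2 ⟨k, Finset.mem_erase.2 ⟨hki, Finset.mem_univ k⟩, ?_⟩
  rw [mem_reducedDemand]
  refine ⟨mem_needers.1 hk, fun β _ hβ => ?_⟩
  obtain ⟨h1, h2⟩ := mem_part.1 hβ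
  have hi : i ∈ (P.holders b)ᶜ := by
    rw [Finset.mem_compl, mem_holders]
    exact hbi
  rw [h2, Finset.mem_insert, Finset.mem_singleton] at hi
  obtain rfl := hi.resolve_left hki.symm
  exact hbp (mem_privateBits.2 ⟨k, hki, mem_part.2 ⟨h1, by rw [h2, Finset.pair_comm]⟩⟩)

namespace IsFinalSelection

variable {W : Finset (Fin m) → Finset (Fin s)} {L : List (Component m s)}
  {U : Finset (Fin m) → Finset (Finset (Fin s))}

/-- The components in question come from `{i}ᶜ` and share a need `k`, so each contains a moved bit
of `f_{k{i,k}}`. Evaluated at the same `k`, the cost of `U_{{i}ᶜ}` counts bits of `f_{k{i,k}}` that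
were not moved. -/
theorem card_meeting_privateBits_add_le (h : P.IsFinalSelection W L U)
    (hP : ∀ b : Fin s, (P.holders b).card = 0 ∨ (P.holders b).card = m ∨
      (P.holders b).card + 1 = m ∨ (P.holders b).card + 2 = m) (i : Fin m) :
    ((U Finset.univ).filter fun A => ∃ b ∈ A, b ∈ P.privateBits i).card +
      P.missingCount U {i}ᶜ ≤ (Finset.univ.erase i).sup fun j => (P.part {j} {i, j}).card := by
  have hiu : ({i}ᶜ : Finset (Fin m)) ≠ Finset.univ := by
    intro h
    have := Finset.mem_univ i
    rw [← h] at this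
    simp at this
  have hpd : ∀ (p : Finset (Fin s) → Prop) [DecidablePred p], ∀ A ∈ (U Finset.univ).filter p,
      ∀ B ∈ (U Finset.univ).filter p, A ≠ B → Disjoint A B := fun p _ A hA B hB =>
    h.pairwise_disjoint Finset.univ A (Finset.mem_filter.1 hA).1 B (Finset.mem_filter.1 hB).1
  have hle : ∀ k, k ≠ i → (P.part {k} {i, k}).card ≤
      (Finset.univ.erase i).sup fun j => (P.part {j} {i, j}).card := fun k hk =>
    Finset.le_sup (f := fun j => (P.part {j} {i, j}).card)
      (Finset.mem_erase.2 ⟨hk, Finset.mem_univ k⟩)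
  -- A private bit starts in `U_[m]` only if `i` and `k` are the only decoders. Then `{i}ᶜ` carries
  -- nothing and all private bits lie in one part.
  by_cases hex : ∃ b ∈ P.privateBits i, P.home b = Finset.univ
  · obtain ⟨b, hb, hh⟩ := hex
    obtain ⟨k, hki, hb⟩ := mem_privateBits.1 hb
    obtain ⟨h1, h2⟩ := mem_part.1 hb
    have hu : ({i, k} : Finset (Fin m)) = Finset.univ := by
      rw [home] at hh
      split_ifs at hh with hc
      · rw [← h2, hc]
      · exfalso
        have hi : i ∈ P.needers b ∪ P.holders b := hh ▸ Finset.mem_univ i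
        rw [Finset.mem_union, h1, Finset.mem_singleton] at hi
        have : i ∈ (P.holders b)ᶜ := by rw [h2]; simp
        exact (Finset.mem_compl.1 this) (hi.resolve_left hki.symm)
    have hall : ∀ j, j = i ∨ j = k := by
      intro j
      have := Finset.mem_univ j
      rw [← hu] at this
      simpa using this
    have hW : W {i}ᶜ = ∅ := by
      refine Finset.eq_empty_of_forall_notMem fun c hc => ?_
      have hch := h.placement.home_eq hiu hc
      obtain ⟨j, k', hjk⟩ := exists_isPairBit hP (h.placement.nonempty hc) (hch ▸ hiu)
      have hcu : (P.holders c)ᶜ = Finset.univ := by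
        rw [hjk.holders_eq, compl_compl, ← hu]
        have := hjk.ne
        rcases hall j with rfl | rfl <;> rcases hall k' with rfl | rfl
        · exact absurd rfl this
        · exact Finset.pair_comm _ _
        · rfl
        · exact absurd rfl this
      rw [home, if_pos hcu] at hch
      exact hiu hch.symm
    rw [h.missingCount_eq_zero hiu hW, add_zero]
    refine (card_le_card_of_disjoint_of_meets _ (P.part {k} {i, k}) (hpd _) ?_).trans (hle k hki)
    intro A hA
    obtain ⟨c, hcA, hc⟩ := (Finset.mem_filter.1 hA).2
    obtain ⟨k', hk', hc⟩ := mem_privateBits.1 hc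
    obtain rfl := (hall k').resolve_left hk'
    exact ⟨c, hcA, hc⟩
  push Not at hex
  have hcomp : ∀ A ∈ (U Finset.univ).filter fun A => ∃ b ∈ A, b ∈ P.privateBits i,
      ∃ V ∈ L, V.support = A ∧ V.origin = {i}ᶜ := by
    intro A hA
    obtain ⟨hAU, b, hbA, hb⟩ := Finset.mem_filter.1 hA
    rcases h.mem_univ_iff.1 hAU with ⟨c, -, hc, rfl⟩ | ⟨V, hV, rfl⟩
    · rw [Finset.mem_singleton] at hbA
      exact absurd hc (hbA ▸ hex b hb)
    · refine ⟨V, hV, rfl, ?_⟩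
      rw [← (h.clean hV).home_eq b hbA]
      obtain ⟨k, hk, hbk⟩ := mem_privateBits.1 hb
      exact (isPairBit_of_mem_privateBits hk hbk (hex b hb)).home_eq
  have hpart : ∀ k, k ≠ i → W {i}ᶜ \ P.side k ⊆ P.part {k} {i, k} \ W Finset.univ := by
    intro k hk c hc
    rw [Finset.mem_sdiff] at hc ⊢
    have hch := h.placement.home_eq hiu hc.1
    refine ⟨?_, fun hcu =>
      Finset.disjoint_left.1 (h.placement.disjoint hiu) hc.1 hcu⟩
    obtain ⟨j, k', hjk⟩ := exists_isPairBit hP (h.placement.nonempty hc.1) (hch ▸ hiu)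
    have hj : j = i := by
      rw [hjk.home_eq, compl_inj_iff] at hch
      exact Finset.singleton_injective hch
    subst hj
    have hkm : k ∉ P.holders c := fun h => hc.2 (mem_holders.1 h)
    rw [hjk.holders_eq, Finset.mem_compl, not_not, Finset.mem_insert, Finset.mem_singleton] at hkm
    obtain rfl := hkm.resolve_right hk
    rw [Finset.pair_comm]
    exact hjk.mem_part
  by_cases hne : ((U Finset.univ).filter fun A => ∃ b ∈ A, b ∈ P.privateBits i).Nonempty
  · obtain ⟨A, hA⟩ := hne
    obtain ⟨V, hV, -, hVo⟩ := hcomp A hA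
    obtain ⟨k, hk⟩ := h.xorState.exists_common_need h.terminal {i}ᶜ ⟨V, hV, hVo⟩
    have hbit : ∀ V ∈ L, V.origin = {i}ᶜ → ∃ b ∈ V.support, P.IsPairBit b i k := by
      intro V hV ho
      obtain ⟨b, hb, hkb⟩ := ((h.clean hV).mem_need k).1 (hk V hV ho)
      obtain ⟨j, k', hjk⟩ := (h.clean hV).pairBit b hb
      have hj := (h.clean hV).home_eq b hb
      rw [ho, hjk.home_eq, compl_inj_iff] at hj
      obtain rfl := Finset.singleton_injective hj
      rw [hjk.needers_eq, Finset.mem_singleton] at hkb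
      subst hkb
      exact ⟨b, hb, hjk⟩
    obtain ⟨b, -, hb⟩ := hbit V hV hVo
    have hki : k ≠ i := hb.ne.symm
    have h1 : ((U Finset.univ).filter fun A => ∃ b ∈ A, b ∈ P.privateBits i).card ≤
        (P.part {k} {i, k} ∩ W Finset.univ).card := by
      refine card_le_card_of_disjoint_of_meets _ _ (hpd _) fun A hA => ?_
      obtain ⟨V, hV, rfl, hVo⟩ := hcomp A hA
      obtain ⟨b, hbV, hb⟩ := hbit V hV hVo
      refine ⟨b, hbV, Finset.mem_inter.2 ⟨?_, ?_⟩⟩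
      · rw [Finset.pair_comm]
        exact hb.mem_part
      · exact (mem_excess.1 (h.support_subset hV hbV)).1
    have h2 : P.missingCount U {i}ᶜ ≤ (P.part {k} {i, k} \ W Finset.univ).card := by
      rw [h.missingCount_eq hiu (i := k) (by simpa using hki)]
      exact Finset.card_le_card (hpart k hki)
    have h3 := Finset.card_inter_add_card_sdiff (P.part {k} {i, k}) (W Finset.univ)
    have h4 := hle k hki
    omega
  -- Without such components no particular `k` is singled out; balance allows any `k ≠ i`.
  · rw [Finset.not_nonempty_iff_eq_empty.1 hne, Finset.card_empty, zero_add]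
    rcases ({i}ᶜ : Finset (Fin m)).eq_empty_or_nonempty with he | ⟨k, hk⟩
    · rw [he, missingCount, Finset.sup_empty]
      exact Nat.zero_le _
    · have hki : k ≠ i := by simpa using hk
      rw [h.missingCount_eq hiu hk]
      exact (Finset.card_le_card ((hpart k hki).trans Finset.sdiff_subset)).trans (hle k hki)

/-- The components with private bits of `i`, together with the message `{i}ᶜ`, are paid for by the
maximum. Every other component of `U_[m]` missing at `i` contains a bit of `missingBits i`. Every
other nonempty message below the top has `i` in its index; evaluated at `i`, it also counts such
bits. The placement keeps these bits apart. -/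
theorem sum_missingCount_le (h : P.IsFinalSelection W L U)
    (hP : ∀ b : Fin s, (P.holders b).card = 0 ∨ (P.holders b).card = m ∨
      (P.holders b).card + 1 = m ∨ (P.holders b).card + 2 = m) (i : Fin m) :
    ((U Finset.univ).filter fun A => ¬ A ⊆ P.side i).card +
      ∑ I ∈ Finset.univ.erase Finset.univ, P.missingCount U I ≤
    (P.missingBits i).card +
      (Finset.univ.erase i).sup fun j => (P.part {j} {i, j}).card := by
  have hiu : ({i}ᶜ : Finset (Fin m)) ≠ Finset.univ := by
    intro h
    have := Finset.mem_univ i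
    rw [← h] at this
    simp at this
  have h1 : ((U Finset.univ).filter fun A => ¬ A ⊆ P.side i).card ≤
      ((U Finset.univ).filter fun A => ∃ b ∈ A, b ∈ P.privateBits i).card +
        (P.missingBits i ∩ W Finset.univ).card := by
    rw [← Finset.card_filter_add_card_filter_not
      (s := (U Finset.univ).filter fun A => ¬ A ⊆ P.side i)
      (fun A => ∃ b ∈ A, b ∈ P.privateBits i)]
    refine Nat.add_le_add (Finset.card_le_card ?_) ?_
    · intro A hA
      rw [Finset.mem_filter, Finset.mem_filter] at hA
      exact Finset.mem_filter.2 ⟨hA.1.1, hA.2⟩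
    · refine card_le_card_of_disjoint_of_meets _ _ ?_ ?_
      · intro A hA B hB
        rw [Finset.mem_filter, Finset.mem_filter] at hA hB
        exact h.pairwise_disjoint Finset.univ A hA.1.1 B hB.1.1
      · intro A hA
        rw [Finset.mem_filter, Finset.mem_filter] at hA
        obtain ⟨b, hbA, hb⟩ := Finset.not_subset.1 hA.1.2
        have hbW := h.subset_placement hA.1.1 hbA
        exact ⟨b, hbA, Finset.mem_inter.2 ⟨mem_missingBits.2
          ⟨h.placement.nonempty hbW, hb, fun hbp => hA.2 ⟨b, hbA, hbp⟩⟩, hbW⟩⟩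
  have h2 : ∀ I ∈ (Finset.univ.erase Finset.univ).erase ({i}ᶜ : Finset (Fin m)),
      P.missingCount U I ≤ (P.missingBits i ∩ W I).card := by
    intro I hI
    rw [Finset.mem_erase, Finset.mem_erase] at hI
    obtain ⟨hIi, hIu, -⟩ := hI
    rcases (W I).eq_empty_or_nonempty with he | ⟨b, hb⟩
    · rw [h.missingCount_eq_zero hIu he]
      exact Nat.zero_le _
    have hpair : ∀ c ∈ W I, ∃ j k, P.IsPairBit c j k ∧ I = {j}ᶜ := by
      intro c hc
      have hch := h.placement.home_eq hIu hc
      obtain ⟨j, k, hjk⟩ := exists_isPairBit hP (h.placement.nonempty hc) (hch ▸ hIu)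
      exact ⟨j, k, hjk, hch.symm.trans hjk.home_eq⟩
    obtain ⟨j, k, -, hIj⟩ := hpair b hb
    have hji : j ≠ i := fun h => hIi (h ▸ hIj)
    have hiI : i ∈ I := by
      rw [hIj, Finset.mem_compl, Finset.mem_singleton]
      exact hji.symm
    rw [h.missingCount_eq hIu hiI]
    refine Finset.card_le_card fun c hc => ?_
    rw [Finset.mem_sdiff] at hc
    refine Finset.mem_inter.2 ⟨mem_missingBits.2 ⟨h.placement.nonempty hc.1, hc.2, ?_⟩, hc.1⟩
    intro hcp
    obtain ⟨j', k', hjk', hIj'⟩ := hpair c hc.1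
    exact hIi (hjk'.eq_of_mem_privateBits hcp ▸ hIj')
  have h3 : (P.missingBits i ∩ W Finset.univ).card +
      ∑ I ∈ (Finset.univ.erase Finset.univ).erase ({i}ᶜ : Finset (Fin m)),
        (P.missingBits i ∩ W I).card ≤ (P.missingBits i).card := by
    have hnot : (Finset.univ : Finset (Fin m)) ∉
        (Finset.univ.erase Finset.univ).erase ({i}ᶜ : Finset (Fin m)) := by simp
    rw [← Finset.sum_insert (f := fun I => (P.missingBits i ∩ W I).card) hnot,
      ← Finset.card_biUnion]
    · exact Finset.card_le_card (Finset.biUnion_subset.2 fun I _ => Finset.inter_subset_left)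
    · intro I _ J _ hIJ
      exact Finset.disjoint_of_subset_left Finset.inter_subset_right
        (Finset.disjoint_of_subset_right Finset.inter_subset_right (h.placement.disjoint hIJ))
  have h4 := h.card_meeting_privateBits_add_le hP i
  rw [← Finset.add_sum_erase (Finset.univ.erase Finset.univ) (P.missingCount U)
    (Finset.mem_erase.2 ⟨hiu, Finset.mem_univ _⟩)]
  have h5 := Finset.sum_le_sum h2
  omega

theorem messageRate_le (h : P.IsFinalSelection W L U) (hm : 0 < m)
    (hP : ∀ b : Fin s, (P.holders b).card = 0 ∨ (P.holders b).card = m ∨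
      (P.holders b).card + 1 = m ∨ (P.holders b).card + 2 = m) :
    ∃ i, P.messageRate U ≤ P.rate i := by
  -- The `i` that bounds the whole rate is a decoder missing the most components of `U_[m]`.
  obtain ⟨i, -, hi⟩ := Finset.exists_mem_eq_sup Finset.univ ⟨⟨0, hm⟩, Finset.mem_univ _⟩
    (fun i => ((U Finset.univ).filter fun A => ¬ A ⊆ P.side i).card)
  refine ⟨i, ?_⟩
  rw [h.messageRate_eq, rate, bitEntropy_eq_card, ← Nat.cast_add, Nat.cast_le,
    ← Finset.add_sum_erase Finset.univ (P.missingCount U) (Finset.mem_univ Finset.univ)]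
  have h1 : P.missingCount U Finset.univ =
    ((U Finset.univ).filter fun A => ¬ A ⊆ P.side i).card := hi
  rw [h1]
  exact (h.sum_missingCount_le hP i).trans
    (Nat.add_le_add_right (Finset.card_le_card (missingBits_subset P i)) _)

theorem achievable (h : P.IsFinalSelection W L U)
    (hP : ∀ b : Fin s, (P.holders b).card = 0 ∨ (P.holders b).card = m ∨
      (P.holders b).card + 1 = m ∨ (P.holders b).card + 2 = m) :
    P.Achievable (P.messageRate U) := by
  rw [h.messageRate_eq]
  exact achievable_of_components U (h.decodable hP) _ fun I i hi =>
    Finset.le_sup (f := fun i => ((U I).filter fun A => ¬ A ⊆ P.side i).card) hi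

end IsFinalSelection

/-! ### The DSM+ bound dominates the rates -/

theorem mem_allNewBits_of_forall_notMem_side {σ : Equiv.Perm (Fin m)} {b : Fin s}
    (hn : (P.needers b).Nonempty) (hside : ∀ i, b ∉ P.side i) : b ∈ P.allNewBits σ := by
  obtain ⟨i, hi⟩ := hn
  obtain ⟨k, hk⟩ := exists_isLeast_fin (fun k => b ∈ P.demand (σ k))
    ⟨σ.symm i, by simpa using mem_needers.1 hi⟩
  exact mem_allNewBits.2 ⟨k, mem_newBits.2
    ⟨hk.1, fun l hl hbl => (hk.2 hbl).not_gt hl, fun l _ => hside _⟩⟩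

theorem exists_perm_first {m : ℕ} (hm : 0 < m) (i : Fin m) :
    ∃ σ : Equiv.Perm (Fin m), σ ⟨0, hm⟩ = i :=
  ⟨Equiv.swap ⟨0, hm⟩ i, Equiv.swap_apply_left _ _⟩

theorem exists_perm_first_second {m : ℕ} (hm : 1 < m) {i j : Fin m} (hij : i ≠ j) :
    ∃ σ : Equiv.Perm (Fin m), σ ⟨0, by omega⟩ = i ∧ σ ⟨1, hm⟩ = j := by
  obtain ⟨σ, hσ⟩ := exists_perm_first (by omega : 0 < m) i
  refine ⟨Equiv.trans σ (Equiv.swap (σ ⟨1, hm⟩) j), ?_, ?_⟩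
  · rw [Equiv.trans_apply, hσ]
    refine Equiv.swap_apply_of_ne_of_ne (fun h => ?_) hij
    have := σ.injective (hσ.trans h)
    simp at this
  · rw [Equiv.trans_apply, Equiv.swap_apply_left]

theorem mem_newBits_first (hm : 0 < m) {σ : Equiv.Perm (Fin m)} {b : Fin s}
    (hb : b ∈ P.demand (σ ⟨0, hm⟩)) : b ∈ P.newBits σ ⟨0, hm⟩ := by
  refine mem_newBits.2 ⟨hb, fun l hl => ?_, fun l hl => ?_⟩
  · exact absurd hl (by simp [Fin.lt_def])
  · have : l = ⟨0, hm⟩ := by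
      rw [Fin.le_def] at hl
      exact Fin.ext (by simpa using hl)
    rw [this]
    exact Finset.disjoint_left.1 (P.disjoint_demand_side _) hb

/-- A bit missing at `i` and demanded by some `k ≠ i` but not by `i` is missing at two decoders at
least. If it were missing at exactly these two, it would lie in `f_{k{k,i}}`, which the reduced
demand omits. So nobody has it, and it is new at its first demander. -/
theorem subset_allNewBits (hm : 0 < m) (hP : ∀ b : Fin s, (P.holders b).card = 0 ∨
      (P.holders b).card = m ∨ (P.holders b).card + 1 = m ∨ (P.holders b).card + 2 = m)
    (i : Fin m) {σ : Equiv.Perm (Fin m)} (hσ : σ ⟨0, hm⟩ = i) :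
    (P.demand i ∪ (Finset.univ.erase i).biUnion P.reducedDemand) \ P.side i ⊆ P.allNewBits σ := by
  intro b hb
  obtain ⟨hb, hbi⟩ := Finset.mem_sdiff.1 hb
  by_cases hbd : b ∈ P.demand i
  · exact mem_allNewBits.2 ⟨_, mem_newBits_first hm (hσ.symm ▸ hbd)⟩
  obtain ⟨k, hk, hbk⟩ := Finset.mem_biUnion.1 ((Finset.mem_union.1 hb).resolve_left hbd)
  have hki := Finset.ne_of_mem_erase hk
  obtain ⟨hbk, hpart⟩ := mem_reducedDemand.1 hbk
  refine mem_allNewBits_of_forall_notMem_side ⟨k, mem_needers.2 hbk⟩ ?_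
  have hin : i ∉ P.needers b := fun h => hbd (mem_needers.1 h)
  have hsub : ({k, i} : Finset (Fin m)) ⊆ (P.holders b)ᶜ := by
    rw [Finset.insert_subset_iff, Finset.singleton_subset_iff, Finset.mem_compl, Finset.mem_compl,
      mem_holders, mem_holders]
    exact ⟨Finset.disjoint_left.1 (P.disjoint_demand_side k) hbk, hbi⟩
  have hcard2 : ({k, i} : Finset (Fin m)).card = 2 := Finset.card_pair hki
  have hle := Finset.card_le_card hsub
  have hcard : (P.holders b).card + (P.holders b)ᶜ.card = m := by
    rw [Finset.card_add_card_compl, Fintype.card_fin]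
  have hzero : (P.holders b).card = 0 := by
    rcases hP b with h | h | h | h
    · exact h
    · omega
    · omega
    · exfalso
      have heq : ({k, i} : Finset (Fin m)) = (P.holders b)ᶜ :=
        Finset.eq_of_subset_of_card_le hsub (by omega)
      refine hpart i hki.symm (mem_part.2 ⟨?_, heq.symm⟩)
      refine Finset.eq_singleton_iff_unique_mem.2 ⟨mem_needers.2 hbk, fun l hl => ?_⟩
      have := needers_subset_compl b hl
      rw [← heq, Finset.mem_insert, Finset.mem_singleton] at this
      refine this.resolve_right ?_
      rintro rfl
      exact hin hl
  intro l hl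
  have := mem_holders.2 hl
  rw [Finset.card_eq_zero.1 hzero] at this
  exact Finset.notMem_empty l this

/-- With `i` first and a maximizing `j` second, the bits of `f_{j{i,j}}` are new at `j`. They are
disjoint from the bits in the entropy term, because only `j` demands them and its reduced demand
omits them. -/
theorem rate_le_dsmPlus (hm : 0 < m) (hP : ∀ b : Fin s, (P.holders b).card = 0 ∨
      (P.holders b).card = m ∨ (P.holders b).card + 1 = m ∨ (P.holders b).card + 2 = m)
    (i : Fin m) : P.rate i ≤ P.dsmPlus := by
  rw [rate, bitEntropy_eq_card, ← Nat.cast_add]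
  rcases (Finset.univ.erase i).eq_empty_or_nonempty with he | hne
  · obtain ⟨σ, hσ⟩ := exists_perm_first hm i
    refine le_trans ?_ (card_allNewBits_le_dsmPlus P σ)
    rw [he, Finset.sup_empty, ← he]
    exact Nat.cast_le.2 (Finset.card_le_card (subset_allNewBits hm hP i hσ))
  · obtain ⟨j, hj, hsup⟩ := Finset.exists_mem_eq_sup _ hne fun j => (P.part {j} {i, j}).card
    have hji := Finset.ne_of_mem_erase hj
    have hm1 : 1 < m := by
      by_contra! hle
      exact hji (Fin.ext (by omega))
    obtain ⟨σ, hσ0, hσ1⟩ := exists_perm_first_second hm1 hji.symm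
    refine le_trans ?_ (card_allNewBits_le_dsmPlus P σ)
    rw [hsup, ← Finset.card_union_of_disjoint, Nat.cast_le]
    · refine Finset.card_le_card (Finset.union_subset (subset_allNewBits hm hP i hσ0) ?_)
      intro b hb
      obtain ⟨h1, h2⟩ := mem_part.1 hb
      have hbi : b ∉ P.side i := by
        rw [← mem_holders, ← Finset.mem_compl, h2]; simp
      have hbj : b ∉ P.side j := by
        rw [← mem_holders, ← Finset.mem_compl, h2]; simp
      have hl : ∀ l : Fin m, l ≤ ⟨1, hm1⟩ → l = ⟨0, hm⟩ ∨ l = ⟨1, hm1⟩ := by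
        intro l hl
        rw [Fin.le_def] at hl
        simp only [Fin.ext_iff]
        simp only at hl
        omega
      refine mem_allNewBits.2 ⟨⟨1, hm1⟩, mem_newBits.2 ⟨?_, fun l hlt => ?_, fun l hle => ?_⟩⟩
      · rw [hσ1, ← mem_needers, h1]
        exact Finset.mem_singleton_self j
      · obtain rfl := (hl l hlt.le).resolve_right hlt.ne
        rw [hσ0, ← mem_needers, h1, Finset.mem_singleton]
        exact hji.symm
      · rcases hl l hle with rfl | rfl
        · rwa [hσ0]
        · rwa [hσ1]
    · rw [Finset.disjoint_left]
      intro b hb hbp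
      obtain ⟨h1, h2⟩ := mem_part.1 hbp
      have hneed : ∀ k, b ∈ P.demand k → k = j := by
        intro k hk
        rw [← mem_needers, h1, Finset.mem_singleton] at hk
        exact hk
      rcases Finset.mem_union.1 (Finset.mem_sdiff.1 hb).1 with hb | hb
      · exact hji (hneed i hb).symm
      · obtain ⟨k, -, hbk⟩ := Finset.mem_biUnion.1 hb
        obtain ⟨hbk, hpart⟩ := mem_reducedDemand.1 hbk
        obtain rfl := hneed k hbk
        exact hpart i hji.symm (mem_part.2 ⟨h1, by rw [h2, Finset.pair_comm]⟩)

end IndexCoding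

/-! ### Closing the cycle of inequalities -/

theorem theorem3 {m s : ℕ} (hm : 0 < m) (P : IndexCoding m s)
    (hP : ∀ b : Fin s, (P.holders b).card = 0 ∨ (P.holders b).card = m ∨
      (P.holders b).card + 1 = m ∨ (P.holders b).card + 2 = m) :
    IsGLB {R : ℝ | P.Achievable R} P.optimalRate ∧
    P.optimalRate = ⨆ i : Fin m, P.rate i ∧
    (∃ U, P.IsCAPMOutcome U) ∧
    (∀ U, P.IsCAPMOutcome U → P.Feasible U ∧ P.messageRate U = P.optimalRate) ∧
    P.dsmPlus = P.optimalRate := by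
  have : Nonempty (Fin m) := ⟨⟨0, hm⟩⟩
  have hsup : ⨆ i : Fin m, P.rate i ≤ P.dsmPlus :=
    ciSup_le fun i => IndexCoding.rate_le_dsmPlus hm hP i
  have hout : ∀ U, P.IsCAPMOutcome U → P.Feasible U ∧ P.Achievable (P.messageRate U) ∧
      P.messageRate U = P.dsmPlus ∧ P.dsmPlus = ⨆ i : Fin m, P.rate i := by
    intro U hU
    obtain ⟨W, L, h⟩ := hU.exists_isFinalSelection hP
    have hach := h.achievable hP
    obtain ⟨i, hi⟩ := h.messageRate_le hm hP
    have h1 : P.messageRate U ≤ ⨆ i : Fin m, P.rate i :=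
      hi.trans (le_ciSup (Set.finite_range _).bddAbove i)
    have h2 := IndexCoding.dsmPlus_le_of_achievable hach
    exact ⟨h.feasible hP, hach, le_antisymm (h1.trans hsup) h2,
      le_antisymm (h2.trans h1) hsup⟩
  obtain ⟨U, hU⟩ := IndexCoding.exists_isCAPMOutcome P
  obtain ⟨-, hach, hrate, hdsm⟩ := hout U hU
  -- The infimum is attained, so `optimalRate` is a genuine greatest lower bound and not the default
  -- value of `sInf`.
  have hleast : IsLeast {R : ℝ | P.Achievable R} P.dsmPlus :=
    ⟨by rw [← hrate]; exact hach, fun R hR => IndexCoding.dsmPlus_le_of_achievable hR⟩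
  have hopt : P.optimalRate = P.dsmPlus := hleast.csInf_eq
  refine ⟨hopt ▸ hleast.isGLB, hopt.trans hdsm, ⟨U, hU⟩, fun U hU => ?_, hopt.symm⟩
  obtain ⟨h1, -, h2, -⟩ := hout U hU
  exact ⟨h1, h2.trans hopt.symm⟩
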